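/- Let $q:\mathbb R\to\mathbb R$ be locally integrable and even, $q(-x)=q(x)$, and let $\tau_q(y)=-y''-qy$ be in the limit circle case at $+\infty$ and at $-\infty$, i.e. for every $\lambda\in\mathbb C$ every solution $y$ of $\tau_q(y)=\lambda y$ (with $y,y'\in AC_{loc}(\mathbb R)$) is square integrable near $+\infty$ and near $-\infty$. Let $\mathcal D_{\max}=\{y\in L^2(\mathbb R): y,y'\in AC_{loc}(\mathbb R),\ \tau_q(y)\in L^2(\mathbb R)\}$, let $A_{\max}y=\tau_q(y)$ on $\mathcal D_{\max}$, and let $A$ (the minimal operator) be the closure of the restriction of $A_{\max}$ to the functions in $\mathcal D_{\max}$ with compact support. A closed operator $\widetilde A$ in $L^2(\mathbb R)$ with $A\subset\widetilde A\subset A^*$ and $\dim(\operatorname{dom}\widetilde A/\operatorname{dom}A)=3$ is called a $3$-dimensional bi-extension of $A$. Put $[f,g]_x=\overline{f(x)}g'(x)-\overline{f'(x)}g(x)$ and $[f,g]_{\pm\infty}=\lim_{x\to\pm\infty}[f,g]_x$ for $f,g\in\mathcal D_{\max}$. (1) There are real-valued solutions $w_1,w_2\in\mathcal D_{\max}$ of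 $\tau_q(y)=0$ with $w_1$ odd, $w_2$ even, $[w_1,w_2]_{\pm\infty}=1$ and $[w_1,w_1]_{\pm\infty}=[w_2,w_2]_{\pm\infty}=0$. (2) For any such $w_1,w_2$ put $\alpha_j(f)=[w_j,f]_{-\infty}$ and $\beta_j(f)=[w_j,f]_{\infty}$, $j=1,2$. An operator $\widetilde A$ in $L^2(\mathbb R)$ is a $3$-dimensional bi-extension of $A$ if and only if it is the restriction of $A_{\max}$ to a domain of the form $$\{f\in\mathcal D_{\max}:\ a\,\alpha_1(f)+b\,\alpha_2(f)=c\,\beta_1(f)+d\,\beta_2(f)\}$$ with $a,b,c,d\in\mathbb C$ not all zero. For every $3$-dimensional bi-extension $\widetilde A$ of $A$, every $\lambda\in\mathbb C\setminus\mathbb R$ is an eigenvalue of $\widetilde A$, and $\sigma(\widetilde A)=\mathbb C$. (3) In particular, there is a $3$-dimensional bi-extension $\widetilde A$ of $A$ with empty resolvent set which is $\mathcal{PT}$ symmetric, i.e. (being closed and densely defined) for all $f\in\operatorname{dom}\widetilde A$ it satisfies $\mathcal{PT}f\in\operatorname{dom}\widetilde A$ and $\mathcal{PT}\widetilde Af=\widetilde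 A\,\mathcal{PT}f$, where $(\mathcal{PT}f)(x)=\overline{f(-x)}$. -/

import Mathlib

open MeasureTheory Filter Topology Set
open scoped ComplexConjugate ENNReal

noncomputable section

namespace SturmLiouville

/-- The Hilbert space `L²(ℝ)` of complex-valued functions. -/
abbrev L2 : Type := Lp ℂ 2 (volume : Measure ℝ)

/-- `AC_loc(ℝ)`: absolutely continuous on every compact interval. -/
def ACLoc (y : ℝ → ℂ) : Prop := ∀ a b : ℝ, AbsolutelyContinuousOnInterval y a b

/-- `y` is differentiable and both `y` and `y'` belong to `AC_loc(ℝ)`. -/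
structure IsRegular (y : ℝ → ℂ) : Prop where
  differentiable : Differentiable ℝ y
  acLoc : ACLoc y
  acLoc_deriv : ACLoc (deriv y)

/-- The differential expression `τ_q y = -y'' - q y`; for regular `y` the second derivative
exists almost everywhere. -/
def tau (q : ℝ → ℝ) (y : ℝ → ℂ) : ℝ → ℂ := fun x => -deriv (deriv y) x - (q x : ℂ) * y x

/-- `y` solves `τ_q y = l y` (in the Carathéodory sense). -/
def IsSolution (q : ℝ → ℝ) (l : ℂ) (y : ℝ → ℂ) : Prop :=
  IsRegular y ∧ ∀ᵐ x : ℝ, tau q y x = l * y x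

/-- Limit circle case at `+∞`: all solutions of `τ_q y = l y`, `l ∈ ℂ`, are square integrable
near `+∞`. -/
def LimitCircleAtTop (q : ℝ → ℝ) : Prop :=
  ∀ (l : ℂ) (y : ℝ → ℂ), IsSolution q l y → ∃ a : ℝ, MemLp y 2 (volume.restrict (Ioi a))

/-- Limit circle case at `-∞`: all solutions of `τ_q y = l y`, `l ∈ ℂ`, are square integrable
near `-∞`. -/
def LimitCircleAtBot (q : ℝ → ℝ) : Prop :=
  ∀ (l : ℂ) (y : ℝ → ℂ), IsSolution q l y → ∃ a : ℝ, MemLp y 2 (volume.restrict (Iio a))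

theorem ACLoc.ae_differentiableAt {y : ℝ → ℂ} (h : ACLoc y) :
    ∀ᵐ x : ℝ, DifferentiableAt ℝ y x := by
  have hv : LocallyBoundedVariationOn y univ := by
    intro a b _ _
    rw [univ_inter]
    rcases le_total a b with hab | hab
    · simpa [uIcc_of_le hab] using (h a b).boundedVariationOn
    · have hs : (Icc a b).Subsingleton := by
        intro u hu v hv
        linarith [hu.1, hu.2, hv.1, hv.2, le_antisymm (hu.1.trans hu.2) hab,
          le_antisymm (hv.1.trans hv.2) hab]
      simp [BoundedVariationOn, eVariationOn.subsingleton _ hs]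
  exact hv.ae_differentiableAt

theorem IsRegular.zero : IsRegular 0 := by
  have h0 : ACLoc (fun _ => (0 : ℂ)) := fun a b =>
    contDiffOn_const.absolutelyContinuousOnInterval
  refine ⟨differentiable_const _, h0, ?_⟩
  have : deriv (0 : ℝ → ℂ) = fun _ => 0 := by ext x; simp
  rw [this]; exact h0

theorem IsRegular.add {y z : ℝ → ℂ} (hy : IsRegular y) (hz : IsRegular z) :
    IsRegular (y + z) := by
  have hd : deriv (y + z) = deriv y + deriv z := by
    ext x; exact deriv_add (hy.differentiable x) (hz.differentiable x)
  refine ⟨hy.differentiable.add hz.differentiable, fun a b => (hy.acLoc a b).add (hz.acLoc a b), ?_⟩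
  rw [hd]
  exact fun a b => (hy.acLoc_deriv a b).add (hz.acLoc_deriv a b)

theorem IsRegular.smul {y : ℝ → ℂ} (c : ℂ) (hy : IsRegular y) : IsRegular (c • y) := by
  have hd : deriv (c • y) = c • deriv y := by
    ext x; exact deriv_const_smul c (hy.differentiable x)
  refine ⟨hy.differentiable.const_smul c, fun a b => (hy.acLoc a b).const_smul c, ?_⟩
  rw [hd]
  exact fun a b => (hy.acLoc_deriv a b).const_smul c

theorem tau_add (q : ℝ → ℝ) {y z : ℝ → ℂ} (hy : IsRegular y) (hz : IsRegular z) :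
    tau q (y + z) =ᵐ[volume] tau q y + tau q z := by
  have hd : deriv (y + z) = deriv y + deriv z := by
    ext x; exact deriv_add (hy.differentiable x) (hz.differentiable x)
  filter_upwards [hy.acLoc_deriv.ae_differentiableAt, hz.acLoc_deriv.ae_differentiableAt]
    with x h1 h2
  simp only [tau, hd, Pi.add_apply, deriv_add h1 h2]
  ring

theorem tau_smul (q : ℝ → ℝ) (c : ℂ) {y : ℝ → ℂ} (hy : IsRegular y) :
    tau q (c • y) =ᵐ[volume] c • tau q y := by
  have hd : deriv (c • y) = c • deriv y := by
    ext x; exact deriv_const_smul c (hy.differentiable x)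
  filter_upwards [hy.acLoc_deriv.ae_differentiableAt] with x h1
  simp only [tau, hd, Pi.smul_apply, deriv_const_smul c h1, smul_eq_mul]
  ring

/-- The maximal domain `D_max`, as a space of (regular) functions. -/
def maxDomain (q : ℝ → ℝ) : Submodule ℂ (ℝ → ℂ) where
  carrier := {y | IsRegular y ∧ MemLp y 2 volume ∧ MemLp (tau q y) 2 volume}
  zero_mem' := by
    refine ⟨IsRegular.zero, MemLp.zero, ?_⟩
    have h0 : tau q 0 = 0 := by
      have : deriv (0 : ℝ → ℂ) = 0 := by ext x; simp
      ext x; simp [tau, this]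
    rw [h0]; exact MemLp.zero
  add_mem' := fun {y z} hy hz =>
    ⟨hy.1.add hz.1, hy.2.1.add hz.2.1,
      (memLp_congr_ae (tau_add q hy.1 hz.1)).2 (hy.2.2.add hz.2.2)⟩
  smul_mem' := fun c y hy =>
    ⟨hy.1.smul c, hy.2.1.const_smul c,
      (memLp_congr_ae (tau_smul q c hy.1)).2 (hy.2.2.const_smul c)⟩

/-- The class in `L²(ℝ)` of a function of the maximal domain. -/
def toL2 (q : ℝ → ℝ) : maxDomain q →ₗ[ℂ] L2 where
  toFun y := MemLp.toLp (y : ℝ → ℂ) y.2.2.1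
  map_add' _ _ := rfl
  map_smul' _ _ := rfl

/-- The class of `τ_q y` in `L²(ℝ)`, for `y` in the maximal domain. -/
def tauL2 (q : ℝ → ℝ) : maxDomain q →ₗ[ℂ] L2 where
  toFun y := MemLp.toLp (tau q y) y.2.2.2
  map_add' y z := by
    rw [← MemLp.toLp_add]
    exact (MemLp.toLp_eq_toLp_iff _ _).2 (tau_add q y.2.1 z.2.1)
  map_smul' c y := by
    rw [RingHom.id_apply, ← MemLp.toLp_const_smul]
    exact (MemLp.toLp_eq_toLp_iff _ _).2 (tau_smul q c y.2.1)

theorem toL2_injective (q : ℝ → ℝ) : Function.Injective (toL2 q) := by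
  intro y z h
  have h' : (y : ℝ → ℂ) =ᵐ[volume] (z : ℝ → ℂ) := (MemLp.toLp_eq_toLp_iff y.2.2.1 z.2.2.1).1 h
  exact Subtype.ext (Continuous.ae_eq_iff_eq volume y.2.1.differentiable.continuous
    z.2.1.differentiable.continuous |>.1 h')

/-- The maximal operator `A_max` in `L²(ℝ)`: it sends the class of `y ∈ D_max` to that of
`τ_q y`. -/
def maxOp (q : ℝ → ℝ) : L2 →ₗ.[ℂ] L2 where
  domain := LinearMap.range (toL2 q)
  toFun := tauL2 q ∘ₗ (LinearEquiv.ofInjective (toL2 q) (toL2_injective q)).symm.toLinearMap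

/-- The functions of the maximal domain that have compact support. -/
def compactDomain (q : ℝ → ℝ) : Submodule ℂ (maxDomain q) where
  carrier := {y | HasCompactSupport (y : ℝ → ℂ)}
  zero_mem' := HasCompactSupport.zero
  add_mem' := fun hy hz => HasCompactSupport.add hy hz
  smul_mem' := fun c _ hy => HasCompactSupport.smul_left (f := fun _ => c) hy

/-- The pre-minimal operator `A₀`. -/
def preMinOp (q : ℝ → ℝ) : L2 →ₗ.[ℂ] L2 :=
  (maxOp q).domRestrict ((compactDomain q).map (toL2 q))

/-- The minimal operator `A`, the closure of `A₀`. -/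
def minOp (q : ℝ → ℝ) : L2 →ₗ.[ℂ] L2 := (preMinOp q).closure

/-- `T` is an `r`-dimensional bi-extension of `A`: a closed operator with `A ⊆ T ⊆ A*` and
`dim (dom T / dom A) = r`. -/
def IsBiExtension (A T : L2 →ₗ.[ℂ] L2) (r : ℕ) : Prop :=
  T.IsClosed ∧ A ≤ T ∧ T ≤ A.adjoint ∧
    Module.rank ℂ (T.domain ⧸ A.domain.submoduleOf T.domain) = (r : Cardinal)

/-- The bracket `[f,g]_x = conj (f x) g'(x) - conj (f' x) g(x)`. -/
def bracket (f g : ℝ → ℂ) (x : ℝ) : ℂ := conj (f x) * deriv g x - conj (deriv f x) * g x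

/-- `[f,g]_∞`; the limit exists for `f`, `g` in the maximal domain. -/
def bracketTop (f g : ℝ → ℂ) : ℂ := limUnder atTop (bracket f g)

/-- `[f,g]_{-∞}`; the limit exists for `f`, `g` in the maximal domain. -/
def bracketBot (f g : ℝ → ℂ) : ℂ := limUnder atBot (bracket f g)

/-- `w₁`, `w₂` are real-valued solutions of `τ_q y = 0` in the maximal domain, `w₁` odd and `w₂`
even, with `[w₁,w₂]_{±∞} = 1` and `[w₁,w₁]_{±∞} = [w₂,w₂]_{±∞} = 0`. -/
structure IsBoundaryPair (q : ℝ → ℝ) (w₁ w₂ : ℝ → ℂ) : Prop where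
  mem₁ : w₁ ∈ maxDomain q
  mem₂ : w₂ ∈ maxDomain q
  sol₁ : IsSolution q 0 w₁
  sol₂ : IsSolution q 0 w₂
  real₁ : ∀ x, (w₁ x).im = 0
  real₂ : ∀ x, (w₂ x).im = 0
  odd₁ : ∀ x, w₁ (-x) = -w₁ x
  even₂ : ∀ x, w₂ (-x) = w₂ x
  bot₁₂ : Tendsto (bracket w₁ w₂) atBot (𝓝 1)
  top₁₂ : Tendsto (bracket w₁ w₂) atTop (𝓝 1)
  bot₁₁ : Tendsto (bracket w₁ w₁) atBot (𝓝 0)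
  top₁₁ : Tendsto (bracket w₁ w₁) atTop (𝓝 0)
  bot₂₂ : Tendsto (bracket w₂ w₂) atBot (𝓝 0)
  top₂₂ : Tendsto (bracket w₂ w₂) atTop (𝓝 0)

/-- `T` is the restriction of `A_max` to the domain
`{f ∈ D_max : a α₁(f) + b α₂(f) = c β₁(f) + d β₂(f)}`, where `α_j(f) = [w_j,f]_{-∞}` and
`β_j(f) = [w_j,f]_∞`. -/
def HasBoundaryCondition (q : ℝ → ℝ) (w₁ w₂ : ℝ → ℂ) (a b c d : ℂ) (T : L2 →ₗ.[ℂ] L2) : Prop :=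
  T ≤ maxOp q ∧
    ∀ f : L2, f ∈ T.domain ↔ ∃ y : maxDomain q, toL2 q y = f ∧
      a * bracketBot w₁ y + b * bracketBot w₂ y = c * bracketTop w₁ y + d * bracketTop w₂ y

/-- The parity operator `(P f)(x) = f(-x)`. -/
def parity (f : L2) : L2 :=
  Lp.compMeasurePreserving Neg.neg (Measure.measurePreserving_neg (volume : Measure ℝ)) f

/-- The time reversal operator `(T f)(x) = conj (f x)`. -/
def timeReversal (f : L2) : L2 := star f

/-- The closed densely defined operator `T` is `PT` symmetric. -/
def IsPTSymmetric (T : L2 →ₗ.[ℂ] L2) : Prop :=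
  T.IsClosed ∧ Dense (T.domain : Set L2) ∧
    ∀ f : T.domain, ∃ h : parity (timeReversal f) ∈ T.domain,
      parity (timeReversal (T f)) = T ⟨parity (timeReversal f), h⟩

/-- `l` is an eigenvalue of `T`. -/
def IsEigenvalue (T : L2 →ₗ.[ℂ] L2) (l : ℂ) : Prop :=
  ∃ f : T.domain, (f : L2) ≠ 0 ∧ T f = l • (f : L2)

/-- The resolvent set of `T`: those `l` for which `T - l : dom T → L²(ℝ)` is a bijection with
bounded inverse `R`. -/
def resolventSet (T : L2 →ₗ.[ℂ] L2) : Set ℂ :=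
  {l | ∃ R : L2 →L[ℂ] L2,
    (∀ g : L2, ∃ h : R g ∈ T.domain, T ⟨R g, h⟩ - l • R g = g) ∧
    ∀ f : T.domain, R (T f - l • (f : L2)) = f}

/-- The spectrum of `T`. -/
def spectrumOf (T : L2 →ₗ.[ℂ] L2) : Set ℂ := (resolventSet T)ᶜ

end SturmLiouville

end

/-!
Variation of constants solves `τ_q y = g` with `g` merely locally integrable, and the fundamental
lemma of the calculus of variations shows that a weak solution is a strong one. Hence the adjoint
of the pre-minimal operator is `A_max`, so `A* = A_max` and `A = (A_max)*`.

By Lagrange's identity `⟨τ_q f, g⟩ - ⟨f, τ_q g⟩ = [f,g]_∞ - [f,g]_{-∞}` on `D_max`. Evenness of `q`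
makes the solutions with initial data `(0, -1)` and `(1, 0)` odd and even, and they form a pair
`w₁, w₂` with `[w₁,w₂] = 1`. Plücker's identity then expresses `[f,g]_{±∞}` through the four
boundary values `α₁, α₂, β₁, β₂`, so `dom A` is their common kernel. Solutions of `τ_q y = 0`, cut
off near `-∞`, realise all values in `ℂ⁴`; therefore `dom A_max / dom A ≅ ℂ⁴`, and three-dimensional
bi-extensions correspond to hyperplanes of `ℂ⁴`, each of which is the kernel of one functional.

One linear condition cannot exclude the whole two-dimensional solution space of `τ_q y = λ y`, which
lies in `D_max` by the limit circle hypothesis: every `λ` is an eigenvalue. Finally `PT` exchanges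
the two ends, mapping `(α₁, α₂, β₁, β₂)` to the conjugate of `(β₁, -β₂, α₁, -α₂)`, so that the
condition `α₁ = β₁` is `PT` symmetric.
-/

noncomputable section

namespace SturmLiouville

theorem absolutelyContinuousOnInterval_of_dist_le {X Y : Type*} [PseudoMetricSpace X]
    [PseudoMetricSpace Y] {f : ℝ → X} {g : ℝ → Y} {a b : ℝ} (K : ℝ)
    (hf : AbsolutelyContinuousOnInterval f a b)
    (h : ∀ x ∈ uIcc a b, ∀ y ∈ uIcc a b, dist (g x) (g y) ≤ K * dist (f x) (f y)) :
    AbsolutelyContinuousOnInterval g a b := by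
  have hlim := Tendsto.const_mul K hf
  rw [mul_zero] at hlim
  refine squeeze_zero' (Eventually.of_forall fun _ => Finset.sum_nonneg fun _ _ => dist_nonneg)
    ?_ hlim
  rw [eventually_inf_principal]
  filter_upwards with I hI
  rw [Finset.mul_sum]
  exact Finset.sum_le_sum fun i hi => h _ (hI.1 i hi).1 _ (hI.1 i hi).2

section LocallyIntegrable

variable {E : Type*} [NormedAddCommGroup E] {f : ℝ → E}

theorem locallyIntegrable_iff_intervalIntegrable {μ : Measure ℝ} :
    LocallyIntegrable f μ ↔ ∀ a b, IntervalIntegrable f μ a b where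
  mp hf _ _ := intervalIntegrable_iff.2
    ((hf.integrableOn_isCompact isCompact_uIcc).mono_set uIoc_subset_uIcc)
  mpr h x := ⟨Ioc (x - 1) (x + 1), Ioc_mem_nhds (by linarith) (by linarith),
    (intervalIntegrable_iff_integrableOn_Ioc_of_le (by linarith)).1 (h _ _)⟩

theorem locallyIntegrable_norm {μ : Measure ℝ} (hf : LocallyIntegrable f μ) :
    LocallyIntegrable (fun x => ‖f x‖) μ :=
  hf.mono hf.aestronglyMeasurable.norm (ae_of_all _ fun _ => (norm_norm _).le)

theorem locallyIntegrable_comp_neg (hf : LocallyIntegrable f volume) :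
    LocallyIntegrable (fun x => f (-x)) volume := by
  rw [← Measure.map_neg_eq_self (volume : Measure ℝ)] at hf
  exact (locallyIntegrable_map_homeomorph (Homeomorph.neg ℝ)).1 hf

variable [NormedSpace ℝ E]

theorem continuous_integral_of_locallyIntegrable (hf : LocallyIntegrable f volume) (c : ℝ) :
    Continuous fun x => ∫ t in c..x, f t :=
  intervalIntegral.continuous_primitive (locallyIntegrable_iff_intervalIntegrable.1 hf) c

theorem absolutelyContinuousOnInterval_integral (hf : LocallyIntegrable f volume) (c a b : ℝ) :
    AbsolutelyContinuousOnInterval (fun x => ∫ t in c..x, f t) a b := by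
  have hi := locallyIntegrable_iff_intervalIntegrable.1 hf
  refine absolutelyContinuousOnInterval_of_dist_le 1
    ((hi a b).norm.absolutelyContinuousOnInterval_intervalIntegral left_mem_uIcc) ?_
  intro x _ y _
  rw [one_mul, dist_eq_norm, dist_eq_norm,
    intervalIntegral.integral_interval_sub_left (hi _ _) (hi _ _),
    intervalIntegral.integral_interval_sub_left (hi _ _).norm (hi _ _).norm]
  exact intervalIntegral.norm_integral_le_abs_integral_norm

theorem integral_eq_sub_of_ae_hasDerivAt [CompleteSpace E] {F : ℝ → E}
    (hF : ∀ a b, AbsolutelyContinuousOnInterval F a b) (hf : LocallyIntegrable f volume)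
    (hd : ∀ᵐ x : ℝ, HasDerivAt F (f x) x) (a b : ℝ) : ∫ x in a..b, f x = F b - F a := by
  have hac : AbsolutelyContinuousOnInterval (fun x => F x - ∫ t in a..x, f t) a b :=
    (hF a b).fun_sub (absolutelyContinuousOnInterval_integral hf a a b)
  obtain ⟨C, hC⟩ := hac.const_of_ae_hasDerivAt_zero (by
    filter_upwards [hd, LocallyIntegrable.ae_hasDerivAt_integral hf] with x h₁ h₂ _
    simpa using h₁.fun_sub (h₂ a))
  have ha := hC a left_mem_uIcc
  have hb := hC b right_mem_uIcc
  simp only [intervalIntegral.integral_same, sub_zero] at ha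
  rw [ha, ← hb, sub_sub_cancel]

end LocallyIntegrable

section ACLoc

variable {f g : ℝ → ℂ}

theorem ACLoc.continuous (hf : ACLoc f) : Continuous f := by
  rw [continuous_iff_continuousAt]
  intro x
  refine (hf (x - 1) (x + 1)).continuousOn.continuousAt ?_
  rw [uIcc_of_le (by linarith)]
  exact Icc_mem_nhds (by linarith) (by linarith)

theorem ACLoc.const (c : ℂ) : ACLoc fun _ => c := fun _ _ =>
  contDiffOn_const.absolutelyContinuousOnInterval

theorem ACLoc.add (hf : ACLoc f) (hg : ACLoc g) : ACLoc fun x => f x + g x :=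
  fun a b => (hf a b).fun_add (hg a b)

theorem ACLoc.sub (hf : ACLoc f) (hg : ACLoc g) : ACLoc fun x => f x - g x :=
  fun a b => (hf a b).fun_sub (hg a b)

theorem ACLoc.neg (hf : ACLoc f) : ACLoc fun x => -f x :=
  fun a b => (hf a b).fun_neg

theorem ACLoc.mul (hf : ACLoc f) (hg : ACLoc g) : ACLoc fun x => f x * g x :=
  fun a b => (hf a b).fun_smul (hg a b)

theorem ACLoc.conj (hf : ACLoc f) : ACLoc fun x => conj (f x) := fun a b =>
  absolutelyContinuousOnInterval_of_dist_le 1 (hf a b) fun x _ y _ => by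
    rw [one_mul, Complex.dist_conj_conj]

theorem ACLoc.integral (hf : LocallyIntegrable f volume) (c : ℝ) :
    ACLoc fun x => ∫ t in c..x, f t :=
  absolutelyContinuousOnInterval_integral hf c

theorem ACLoc.of_contDiff (hf : ContDiff ℝ 1 f) : ACLoc f := fun _ _ =>
  hf.contDiffOn.absolutelyContinuousOnInterval

theorem ACLoc.of_hasDerivAt (hf : ∀ x, HasDerivAt f (g x) x) (hg : Continuous g) : ACLoc f :=
  .of_contDiff <| contDiff_one_iff_deriv.2
    ⟨fun x => (hf x).differentiableAt, (funext fun x => (hf x).deriv : deriv f = g) ▸ hg⟩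

theorem ACLoc.locallyIntegrable_deriv (hf : ACLoc f) : LocallyIntegrable (deriv f) volume := by
  have hre : LocallyIntegrable (deriv fun x => (f x).re) volume :=
    locallyIntegrable_iff_intervalIntegrable.2 fun a b =>
      (absolutelyContinuousOnInterval_of_dist_le 1 (hf a b) fun x _ y _ => by
        rw [one_mul, Real.dist_eq, dist_eq_norm, ← Complex.sub_re]
        exact Complex.abs_re_le_norm _).intervalIntegrable_deriv
  have him : LocallyIntegrable (deriv fun x => (f x).im) volume :=
    locallyIntegrable_iff_intervalIntegrable.2 fun a b =>
      (absolutelyContinuousOnInterval_of_dist_le 1 (hf a b) fun x _ y _ => by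
        rw [one_mul, Real.dist_eq, dist_eq_norm, ← Complex.sub_im]
        exact Complex.abs_im_le_norm _).intervalIntegrable_deriv
  refine ((hre.smul_continuous (continuous_const (y := (1 : ℂ)))).add
    (him.smul_continuous (continuous_const (y := Complex.I)))).congr ?_
  filter_upwards [hf.ae_differentiableAt] with x hx
  have hx_re : HasDerivAt (fun x => (f x).re) (deriv f x).re x :=
    Complex.reCLM.hasFDerivAt.comp_hasDerivAt x hx.hasDerivAt
  have hx_im : HasDerivAt (fun x => (f x).im) (deriv f x).im x :=
    Complex.imCLM.hasFDerivAt.comp_hasDerivAt x hx.hasDerivAt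
  simp [hx_re.deriv, hx_im.deriv, Complex.re_add_im]

theorem ACLoc.integral_eq_sub (hf : ACLoc f) (hd : ∀ᵐ x : ℝ, HasDerivAt f (g x) x) (a b : ℝ) :
    ∫ x in a..b, g x = f b - f a :=
  integral_eq_sub_of_ae_hasDerivAt hf
    (hf.locallyIntegrable_deriv.congr (hd.mono fun _ hx => hx.deriv)) hd a b

theorem ACLoc.hasDerivAt_of_continuous (hf : ACLoc f) (hd : ∀ᵐ x : ℝ, HasDerivAt f (g x) x)
    (hg : Continuous g) (x : ℝ) : HasDerivAt f (g x) x := by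
  have h : f = fun x => f 0 + ∫ t in (0 : ℝ)..x, g t := by
    ext x
    rw [hf.integral_eq_sub hd, add_sub_cancel]
  rw [h]
  exact (hg.integral_hasStrictDerivAt 0 x).hasDerivAt.const_add _

theorem ACLoc.comp_neg (hf : ACLoc f) : ACLoc fun x => f (-x) := by
  have h : (fun x => f (-x)) = fun x => f 0 - ∫ t in (0 : ℝ)..x, deriv f (-t) := by
    ext x
    rw [intervalIntegral.integral_comp_neg, neg_zero, intervalIntegral.integral_symm,
      hf.integral_eq_sub (hf.ae_differentiableAt.mono fun x hx => hx.hasDerivAt)]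
    ring
  rw [h]
  exact (ACLoc.const _).sub
    (ACLoc.integral (locallyIntegrable_comp_neg hf.locallyIntegrable_deriv) 0)

end ACLoc

/-- The weight `exp (2 |∫₀ˣ m|)` of the Bielecki norm: in the norm `sup ‖Y‖ / bieleckiWeight m`
a Volterra operator whose kernel is bounded by `m` contracts by the factor `1 / 2`. -/
def bieleckiWeight (m : ℝ → ℝ) (x : ℝ) : ℝ := Real.exp (2 * |∫ t in (0 : ℝ)..x, m t|)

section BieleckiWeight

variable {m : ℝ → ℝ}

theorem bieleckiWeight_pos (x : ℝ) : 0 < bieleckiWeight m x := Real.exp_pos _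

theorem one_le_bieleckiWeight (x : ℝ) : 1 ≤ bieleckiWeight m x :=
  Real.one_le_exp (by positivity)

theorem continuous_bieleckiWeight (hm : LocallyIntegrable m volume) :
    Continuous (bieleckiWeight m) := by
  have := continuous_integral_of_locallyIntegrable hm 0
  unfold bieleckiWeight
  fun_prop

theorem integral_mul_exp_integral (hm : LocallyIntegrable m volume) (s a b : ℝ) :
    ∫ x in a..b, s * m x * Real.exp (s * ∫ t in (0 : ℝ)..x, m t) =
      Real.exp (s * ∫ t in (0 : ℝ)..b, m t) - Real.exp (s * ∫ t in (0 : ℝ)..a, m t) := by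
  have hcont := continuous_integral_of_locallyIntegrable hm 0
  refine integral_eq_sub_of_ae_hasDerivAt (F := fun x => Real.exp (s * ∫ t in (0 : ℝ)..x, m t))
    (fun a b => ?_) ((hm.continuous_mul continuous_const).mul_continuous (by fun_prop)) ?_ a b
  · obtain ⟨R, hR⟩ := isCompact_uIcc.exists_bound_of_continuousOn
      (hcont.continuousOn (s := uIcc a b))
    have hexp : ContDiffOn ℝ 1 (fun r => Real.exp (s * r)) (Icc (-R) R) := by fun_prop
    obtain ⟨K, hK⟩ := hexp.exists_lipschitzOnWith (by decide) (convex_Icc _ _) isCompact_Icc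
    exact absolutelyContinuousOnInterval_of_dist_le K
      (absolutelyContinuousOnInterval_integral hm 0 a b) fun x hx y hy =>
        hK.dist_le_mul _ (abs_le.1 (hR x hx)) _ (abs_le.1 (hR y hy))
  · filter_upwards [LocallyIntegrable.ae_hasDerivAt_integral hm] with x hx
    exact ((hx 0).const_mul s).exp.congr_deriv (by ring)

theorem abs_integral_mul_bieleckiWeight_le (hm : LocallyIntegrable m volume)
    (hm₀ : ∀ x, 0 ≤ m x) (x : ℝ) :
    |∫ t in (0 : ℝ)..x, m t * bieleckiWeight m t| ≤ bieleckiWeight m x / 2 := by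
  have of_sign (s : ℝ) (hs : |s| = 2)
      (h : ∀ t ∈ uIcc 0 x, s * (∫ r in (0 : ℝ)..t, m r) = 2 * |∫ r in (0 : ℝ)..t, m r|) :
      |∫ t in (0 : ℝ)..x, m t * bieleckiWeight m t| ≤ bieleckiWeight m x / 2 := by
    have hexp : s * ∫ t in (0 : ℝ)..x, m t * bieleckiWeight m t = bieleckiWeight m x - 1 := by
      calc s * ∫ t in (0 : ℝ)..x, m t * bieleckiWeight m t
        _ = ∫ t in (0 : ℝ)..x, s * m t * Real.exp (s * ∫ r in (0 : ℝ)..t, m r) := by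
          rw [← intervalIntegral.integral_const_mul]
          refine intervalIntegral.integral_congr fun t ht => ?_
          simp only [h t ht, bieleckiWeight, mul_assoc]
        _ = bieleckiWeight m x - 1 := by
          rw [integral_mul_exp_integral hm, h x right_mem_uIcc, intervalIntegral.integral_same,
            mul_zero, Real.exp_zero, bieleckiWeight]
    have habs := congrArg abs hexp
    rw [abs_mul, hs, abs_of_nonneg (sub_nonneg.2 (one_le_bieleckiWeight x))] at habs
    linarith
  rcases le_total 0 x with hx | hx
  · refine of_sign 2 (by norm_num) fun t ht => ?_
    rw [uIcc_of_le hx] at ht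
    rw [abs_of_nonneg (intervalIntegral.integral_nonneg ht.1 fun _ _ => hm₀ _)]
  · refine of_sign (-2) (by norm_num) fun t ht => ?_
    rw [uIcc_of_ge hx] at ht
    rw [intervalIntegral.integral_symm, abs_neg,
      abs_of_nonneg (intervalIntegral.integral_nonneg ht.2 fun _ _ => hm₀ _)]
    ring

end BieleckiWeight

section Volterra

open scoped BoundedContinuousFunction

variable {E : Type*} [NormedAddCommGroup E] [NormedSpace ℝ E] {B : ℝ → E →L[ℝ] E}

theorem locallyIntegrable_clm_apply (hB : LocallyIntegrable B volume) {Y : ℝ → E}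
    (hY : Continuous Y) : LocallyIntegrable (fun t => B t (Y t)) volume :=
  ((locallyIntegrable_norm hB).mul_continuous hY.norm).mono
    ((ContinuousLinearMap.id ℝ (E →L[ℝ] E)).aestronglyMeasurable_comp₂ hB.aestronglyMeasurable
      hY.aestronglyMeasurable)
    (ae_of_all _ fun t => ((B t).le_opNorm (Y t)).trans (Real.le_norm_self _))

theorem norm_integral_clm_apply_bieleckiWeight_smul_le (hB : LocallyIntegrable B volume)
    (Z : ℝ →ᵇ E) (x : ℝ) :
    ‖∫ t in (0 : ℝ)..x, B t (bieleckiWeight (‖B ·‖) t • Z t)‖ ≤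
      bieleckiWeight (‖B ·‖) x / 2 * ‖Z‖ := by
  set W := bieleckiWeight (‖B ·‖)
  have hW : ∀ t, 0 ≤ W t := fun t => (bieleckiWeight_pos t).le
  have hBW : LocallyIntegrable (fun t => ‖B t‖ * W t) volume :=
    (locallyIntegrable_norm hB).mul_continuous
      (continuous_bieleckiWeight (locallyIntegrable_norm hB))
  have hpointwise (t : ℝ) : ‖B t (W t • Z t)‖ ≤ ‖B t‖ * W t * ‖Z‖ := by
    calc ‖B t (W t • Z t)‖ ≤ ‖B t‖ * ‖W t • Z t‖ := (B t).le_opNorm _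
      _ = ‖B t‖ * W t * ‖Z t‖ := by rw [norm_smul, Real.norm_of_nonneg (hW t), mul_assoc]
      _ ≤ ‖B t‖ * W t * ‖Z‖ := by
        gcongr
        · exact mul_nonneg (norm_nonneg _) (hW t)
        · exact Z.norm_coe_le_norm t
  calc ‖∫ t in (0 : ℝ)..x, B t (W t • Z t)‖ ≤ |∫ t in (0 : ℝ)..x, ‖B t‖ * W t * ‖Z‖| :=
        intervalIntegral.norm_integral_le_abs_of_norm_le (ae_of_all _ hpointwise)
          ((locallyIntegrable_iff_intervalIntegrable.1 hBW 0 x).mul_const _)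
    _ = |∫ t in (0 : ℝ)..x, ‖B t‖ * W t| * ‖Z‖ := by
        rw [intervalIntegral.integral_mul_const, abs_mul, abs_of_nonneg (norm_nonneg Z)]
    _ ≤ W x / 2 * ‖Z‖ := by
        gcongr
        exact abs_integral_mul_bieleckiWeight_le (locallyIntegrable_norm hB)
          (fun _ => norm_nonneg _) x

/-- The Picard map of the Volterra equation `Y x = Y₀ + ∫₀ˣ B Y`, acting on `Z = Y / W` with `W`
the Bielecki weight: in this form it acts on the complete space of bounded continuous functions. -/
def picardMap (hB : LocallyIntegrable B volume) (Y₀ : E) (Z : ℝ →ᵇ E) : ℝ →ᵇ E :=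
  BoundedContinuousFunction.ofNormedAddCommGroup
    (fun x => (bieleckiWeight (‖B ·‖) x)⁻¹ •
      (Y₀ + ∫ t in (0 : ℝ)..x, B t (bieleckiWeight (‖B ·‖) t • Z t)))
    (((continuous_bieleckiWeight (locallyIntegrable_norm hB)).inv₀
      fun x => (bieleckiWeight_pos x).ne').smul
      (continuous_const.add (continuous_integral_of_locallyIntegrable
        (locallyIntegrable_clm_apply hB
          ((continuous_bieleckiWeight (locallyIntegrable_norm hB)).smul Z.continuous)) 0)))
    (‖Y₀‖ + 1 / 2 * ‖Z‖) (fun x => by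
      have hW := bieleckiWeight_pos (m := (‖B ·‖)) x
      have hint := norm_integral_clm_apply_bieleckiWeight_smul_le hB Z x
      have hY₀ : ‖Y₀‖ ≤ bieleckiWeight (‖B ·‖) x * ‖Y₀‖ :=
        le_mul_of_one_le_left (norm_nonneg _) (one_le_bieleckiWeight x)
      rw [norm_smul, norm_inv, Real.norm_of_nonneg hW.le, inv_mul_le_iff₀ hW]
      refine (norm_add_le _ _).trans ?_
      linarith)

theorem contractingWith_picardMap (hB : LocallyIntegrable B volume) (Y₀ : E) :
    ContractingWith (1 / 2) (picardMap hB Y₀) := by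
  refine ⟨by norm_num, LipschitzWith.of_dist_le_mul fun Z Z' => ?_⟩
  rw [BoundedContinuousFunction.dist_le (by positivity)]
  intro x
  set W := bieleckiWeight (‖B ·‖) with hW
  have hWx : 0 < W x := bieleckiWeight_pos x
  have hint (Z : ℝ →ᵇ E) : IntervalIntegrable (fun t => B t (W t • Z t)) volume 0 x :=
    locallyIntegrable_iff_intervalIntegrable.1 (locallyIntegrable_clm_apply hB
      ((continuous_bieleckiWeight (locallyIntegrable_norm hB)).smul Z.continuous)) 0 x
  have hdiff : picardMap hB Y₀ Z x - picardMap hB Y₀ Z' x =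
      (W x)⁻¹ • ∫ t in (0 : ℝ)..x, B t (W t • (Z - Z') t) := by
    simp only [picardMap, BoundedContinuousFunction.coe_ofNormedAddCommGroup, ← hW]
    rw [← smul_sub, add_sub_add_left_eq_sub, ← intervalIntegral.integral_sub (hint Z) (hint Z')]
    simp only [← map_sub, ← smul_sub, BoundedContinuousFunction.coe_sub, Pi.sub_apply]
  rw [dist_eq_norm, hdiff, norm_smul, norm_inv, Real.norm_of_nonneg hWx.le,
    inv_mul_le_iff₀ hWx, dist_eq_norm]
  calc _ ≤ W x / 2 * ‖Z - Z'‖ := norm_integral_clm_apply_bieleckiWeight_smul_le hB (Z - Z') x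
    _ = W x * (((1 / 2 : NNReal) : ℝ) * ‖Z - Z'‖) := by
      push_cast
      ring

theorem exists_continuous_eq_add_integral [CompleteSpace E] (hB : LocallyIntegrable B volume)
    (Y₀ : E) : ∃ Y : ℝ → E, Continuous Y ∧ ∀ x, Y x = Y₀ + ∫ t in (0 : ℝ)..x, B t (Y t) := by
  obtain ⟨Z, hZ⟩ : ∃ Z, picardMap hB Y₀ Z = Z :=
    ⟨_, (contractingWith_picardMap hB Y₀).fixedPoint_isFixedPt⟩
  refine ⟨fun x => bieleckiWeight (‖B ·‖) x • Z x,
    (continuous_bieleckiWeight (locallyIntegrable_norm hB)).smul Z.continuous, fun x => ?_⟩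
  exact (inv_smul_eq_iff₀ (bieleckiWeight_pos x).ne').1 (DFunLike.congr_fun hZ x) |>.symm

end Volterra

section Existence

variable {q : ℝ → ℝ}

theorem IsRegular.of_hasDerivAt {y v : ℝ → ℂ} (hy : ∀ x, HasDerivAt y (v x) x) (hv : ACLoc v) :
    IsRegular y :=
  ⟨fun x => (hy x).differentiableAt, ACLoc.of_hasDerivAt hy hv.continuous,
    (funext fun x => (hy x).deriv : deriv y = v) ▸ hv⟩

theorem exists_hasDerivAt_linear_system {p : ℝ → ℂ} (hp : LocallyIntegrable p volume)
    (y₀ v₀ : ℂ) :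
    ∃ y v : ℝ → ℂ, y 0 = y₀ ∧ v 0 = v₀ ∧ (∀ x, HasDerivAt y (v x) x) ∧ ACLoc v ∧
      ∀ᵐ x : ℝ, HasDerivAt v (-(p x * y x)) x := by
  let shift : ℂ × ℂ →L[ℝ] ℂ × ℂ :=
    (ContinuousLinearMap.snd ℝ ℂ ℂ).prod 0
  let feedback : ℂ × ℂ →L[ℝ] ℂ × ℂ :=
    (0 : ℂ × ℂ →L[ℝ] ℂ).prod (-ContinuousLinearMap.fst ℝ ℂ ℂ)
  have hB : LocallyIntegrable (fun t => shift + p t • feedback) volume :=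
    LocallyIntegrable.add (locallyIntegrable_const shift) (hp.smul_continuous continuous_const)
  obtain ⟨Y, hYc, hY⟩ := exists_continuous_eq_add_integral hB (y₀, v₀)
  have hpY : LocallyIntegrable (fun t => -(p t * (Y t).1)) volume :=
    (hp.mul_continuous hYc.fst).neg
  have hint (x : ℝ) := locallyIntegrable_iff_intervalIntegrable.1
    (locallyIntegrable_clm_apply hB hYc) 0 x
  have hfst : (fun x => (Y x).1) = fun x => y₀ + ∫ t in (0 : ℝ)..x, (Y t).2 := by
    ext x
    rw [hY x, Prod.fst_add]
    refine congrArg (y₀ + ·) (((ContinuousLinearMap.fst ℝ ℂ ℂ).intervalIntegral_comp_comm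
      (hint x)).symm.trans ?_)
    simp [shift, feedback]
  have hsnd : (fun x => (Y x).2) = fun x => v₀ + ∫ t in (0 : ℝ)..x, -(p t * (Y t).1) := by
    ext x
    rw [hY x, Prod.snd_add]
    refine congrArg (v₀ + ·) (((ContinuousLinearMap.snd ℝ ℂ ℂ).intervalIntegral_comp_comm
      (hint x)).symm.trans ?_)
    simp [shift, feedback]
  refine ⟨fun x => (Y x).1, fun x => (Y x).2, ?_, ?_, fun x => ?_, ?_, ?_⟩
  · exact (congrFun hfst 0).trans (by simp)
  · exact (congrFun hsnd 0).trans (by simp)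
  · rw [hfst]
    exact (hYc.snd.integral_hasStrictDerivAt 0 x).hasDerivAt.const_add _
  · rw [hsnd]
    exact (ACLoc.const _).add (ACLoc.integral hpY 0)
  · filter_upwards [LocallyIntegrable.ae_hasDerivAt_integral hpY] with x hx
    rw [hsnd]
    exact (hx 0).const_add _

theorem exists_isSolution (hq : LocallyIntegrable q volume) (l y₀ v₀ : ℂ) :
    ∃ y, IsSolution q l y ∧ y 0 = y₀ ∧ deriv y 0 = v₀ := by
  have hp : LocallyIntegrable (fun x => (q x : ℂ) + l) volume := by
    refine LocallyIntegrable.add (f := fun x => (q x : ℂ)) ?_ (locallyIntegrable_const l)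
    simpa using hq.smul_continuous (continuous_const (y := (1 : ℂ)))
  obtain ⟨y, v, hy₀, hv₀, hy, hv, hv'⟩ := exists_hasDerivAt_linear_system hp y₀ v₀
  have hderiv : deriv y = v := funext fun x => (hy x).deriv
  refine ⟨y, ⟨IsRegular.of_hasDerivAt hy hv, ?_⟩, hy₀, hderiv ▸ hv₀⟩
  filter_upwards [hv'] with x hx
  rw [tau, hderiv, hx.deriv]
  ring

end Existence

section Symmetries

variable {q : ℝ → ℝ} {l : ℂ} {y z : ℝ → ℂ}

theorem deriv_conj (f : ℝ → ℂ) : (deriv fun x => conj (f x)) = fun x => conj (deriv f x) :=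
  funext fun x => (deriv.star : deriv (fun y => star (f y)) x = star (deriv f x))

theorem deriv_comp_neg_eq (f : ℝ → ℂ) : (deriv fun x => f (-x)) = fun x => -deriv f (-x) :=
  funext fun x => deriv_comp_neg f x

theorem ae_comp_neg {p : ℝ → Prop} (h : ∀ᵐ x : ℝ, p x) : ∀ᵐ x : ℝ, p (-x) :=
  (Measure.measurePreserving_neg (volume : Measure ℝ)).quasiMeasurePreserving.ae h

theorem IsRegular.conj (hy : IsRegular y) : IsRegular fun x => conj (y x) :=
  ⟨fun x => (hy.differentiable x).star, hy.acLoc.conj, by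
    rw [deriv_conj]
    exact hy.acLoc_deriv.conj⟩

theorem IsRegular.comp_neg (hy : IsRegular y) : IsRegular fun x => y (-x) :=
  ⟨hy.differentiable.comp differentiable_neg, hy.acLoc.comp_neg, by
    rw [deriv_comp_neg_eq]
    exact hy.acLoc_deriv.comp_neg.neg⟩

theorem tau_conj (q : ℝ → ℝ) (y : ℝ → ℂ) (x : ℝ) :
    tau q (fun x => conj (y x)) x = conj (tau q y x) := by
  simp only [tau, deriv_conj, map_sub, map_neg, map_mul, Complex.conj_ofReal]

theorem tau_comp_neg (heven : ∀ᵐ x : ℝ, q (-x) = q x) (y : ℝ → ℂ) :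
    tau q (fun x => y (-x)) =ᵐ[volume] fun x => tau q y (-x) := by
  filter_upwards [heven] with x hx
  simp only [tau, deriv_comp_neg_eq, hx]
  rw [deriv.fun_neg, deriv_comp_neg, neg_neg]

theorem IsSolution.add (hy : IsSolution q l y) (hz : IsSolution q l z) :
    IsSolution q l (y + z) := by
  refine ⟨hy.1.add hz.1, ?_⟩
  filter_upwards [tau_add q hy.1 hz.1, hy.2, hz.2] with x h hyx hzx
  rw [h, Pi.add_apply, hyx, hzx, Pi.add_apply, mul_add]

theorem IsSolution.smul (c : ℂ) (hy : IsSolution q l y) : IsSolution q l (c • y) := by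
  refine ⟨hy.1.smul c, ?_⟩
  filter_upwards [tau_smul q c hy.1, hy.2] with x h hyx
  rw [h, Pi.smul_apply, hyx, Pi.smul_apply, smul_eq_mul, smul_eq_mul, mul_left_comm]

theorem IsSolution.conj (hy : IsSolution q l y) :
    IsSolution q (conj l) fun x => conj (y x) := by
  refine ⟨hy.1.conj, ?_⟩
  filter_upwards [hy.2] with x hyx
  rw [tau_conj, hyx, map_mul]

theorem IsSolution.comp_neg (heven : ∀ᵐ x : ℝ, q (-x) = q x) (hy : IsSolution q l y) :
    IsSolution q l fun x => y (-x) := by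
  refine ⟨hy.1.comp_neg, ?_⟩
  filter_upwards [tau_comp_neg heven y, ae_comp_neg hy.2] with x h hyx
  rw [h, hyx]

end Symmetries

section Wronskian

variable {q : ℝ → ℝ} {l : ℂ} {f g y z w₁ w₂ : ℝ → ℂ}

/-- The Wronskian `f g' - f' g`, the bilinear companion of the sesquilinear `bracket`. -/
def wronskian (f g : ℝ → ℂ) (x : ℝ) : ℂ := f x * deriv g x - deriv f x * g x

theorem bracket_eq_wronskian (f g : ℝ → ℂ) : bracket f g = wronskian (fun x => conj (f x)) g := by
  ext x
  rw [wronskian, deriv_conj, bracket]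

theorem bracket_of_real {w : ℝ → ℂ} (hw : ∀ x, (w x).im = 0) (f : ℝ → ℂ) :
    bracket w f = wronskian w f := by
  rw [bracket_eq_wronskian, funext fun x => Complex.conj_eq_iff_im.2 (hw x)]

theorem wronskian_self (f : ℝ → ℂ) (x : ℝ) : wronskian f f x = 0 := by
  rw [wronskian]
  ring

theorem wronskian_comp_neg (f g : ℝ → ℂ) (x : ℝ) :
    wronskian (fun x => f (-x)) (fun x => g (-x)) x = -wronskian f g (-x) := by
  simp only [wronskian, deriv_comp_neg_eq]
  ring

theorem wronskian_mul_wronskian (f g u v : ℝ → ℂ) (x : ℝ) :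
    wronskian u v x * wronskian f g x =
      wronskian u f x * wronskian v g x - wronskian v f x * wronskian u g x := by
  simp only [wronskian]
  ring

theorem IsRegular.acLoc_wronskian (hf : IsRegular f) (hg : IsRegular g) : ACLoc (wronskian f g) :=
  (hf.acLoc.mul hg.acLoc_deriv).sub (hf.acLoc_deriv.mul hg.acLoc)

theorem IsRegular.ae_hasDerivAt_deriv (q : ℝ → ℝ) (hy : IsRegular y) :
    ∀ᵐ x : ℝ, HasDerivAt (deriv y) (-(q x * y x) - tau q y x) x := by
  filter_upwards [hy.acLoc_deriv.ae_differentiableAt] with x hx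
  refine hx.hasDerivAt.congr_deriv ?_
  rw [tau]
  ring

theorem IsRegular.ae_hasDerivAt_wronskian (q : ℝ → ℝ) (hf : IsRegular f) (hg : IsRegular g) :
    ∀ᵐ x : ℝ, HasDerivAt (wronskian f g) (tau q f x * g x - f x * tau q g x) x := by
  filter_upwards [hf.ae_hasDerivAt_deriv q, hg.ae_hasDerivAt_deriv q] with x hfx hgx
  refine (((hf.differentiable x).hasDerivAt.mul hgx).sub
    (hfx.mul (hg.differentiable x).hasDerivAt)).congr_deriv ?_
  ring

theorem IsRegular.integral_lagrange (q : ℝ → ℝ) (hf : IsRegular f) (hg : IsRegular g) (a b : ℝ) :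
    ∫ x in a..b, (conj (tau q f x) * g x - conj (f x) * tau q g x) =
      bracket f g b - bracket f g a := by
  simp only [bracket_eq_wronskian, ← tau_conj]
  exact (hf.conj.acLoc_wronskian hg).integral_eq_sub (hf.conj.ae_hasDerivAt_wronskian q hg) a b

theorem IsSolution.wronskian_eq (hf : IsSolution q l f) (hg : IsSolution q l g) (a b : ℝ) :
    wronskian f g a = wronskian f g b := by
  have hzero : ∀ᵐ x : ℝ, HasDerivAt (wronskian f g) 0 x := by
    filter_upwards [hf.1.ae_hasDerivAt_wronskian q hg.1, hf.2, hg.2] with x h hfx hgx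
    refine h.congr_deriv ?_
    rw [hfx, hgx]
    ring
  have h := (hf.1.acLoc_wronskian hg.1).integral_eq_sub hzero b a
  rw [intervalIntegral.integral_zero] at h
  exact sub_eq_zero.1 h.symm

theorem IsSolution.ext (hq : LocallyIntegrable q volume) (hy : IsSolution q l y)
    (hz : IsSolution q l z) (h₀ : y 0 = z 0) (h₁ : deriv y 0 = deriv z 0) : y = z := by
  obtain ⟨u, hu, hu₀, hu₁⟩ := exists_isSolution hq l 1 0
  obtain ⟨v, hv, hv₀, hv₁⟩ := exists_isSolution hq l 0 1
  have hwronskian {w : ℝ → ℂ} (hw : IsSolution q l w) (x : ℝ) :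
      wronskian w y x = wronskian w z x := by
    rw [hw.wronskian_eq hy x 0, hw.wronskian_eq hz x 0, wronskian, wronskian, h₀, h₁]
  ext x
  have huv : wronskian u v x = 1 := by
    rw [hu.wronskian_eq hv x 0, wronskian, hu₀, hu₁, hv₀, hv₁]
    ring
  have hux := hwronskian hu x
  have hvx := hwronskian hv x
  simp only [wronskian] at huv hux hvx
  linear_combination (z x - y x) * huv + v x * hux - u x * hvx

/-- A fundamental system of `τ_q y = 0`, normalised to have Wronskian `1`. -/
structure IsFundamentalPair (q : ℝ → ℝ) (w₁ w₂ : ℝ → ℂ) : Prop where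
  sol₁ : IsSolution q 0 w₁
  sol₂ : IsSolution q 0 w₂
  wronskian_eq_one : ∀ x, wronskian w₁ w₂ x = 1

theorem IsFundamentalPair.of_initial_values (h₁ : IsSolution q 0 w₁) (h₂ : IsSolution q 0 w₂)
    (h : wronskian w₁ w₂ 0 = 1) : IsFundamentalPair q w₁ w₂ :=
  ⟨h₁, h₂, fun x => (h₁.wronskian_eq h₂ x 0).trans h⟩

theorem exists_isFundamentalPair (hq : LocallyIntegrable q volume) :
    ∃ w₁ w₂, IsFundamentalPair q w₁ w₂ := by
  obtain ⟨w₁, h₁, h₁₀, h₁₁⟩ := exists_isSolution hq 0 1 0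
  obtain ⟨w₂, h₂, h₂₀, h₂₁⟩ := exists_isSolution hq 0 0 1
  exact ⟨w₁, w₂, .of_initial_values h₁ h₂ (by simp [wronskian, h₁₀, h₁₁, h₂₀, h₂₁])⟩

end Wronskian

section BoundaryPair

variable {q : ℝ → ℝ} {l : ℂ} {y w₁ w₂ : ℝ → ℂ}

theorem memLp_two_of_continuous (hy : Continuous y) {a b : ℝ}
    (ha : MemLp y 2 (volume.restrict (Ioi a))) (hb : MemLp y 2 (volume.restrict (Iio b))) :
    MemLp y 2 volume := by
  rw [memLp_two_iff_integrable_sq_norm hy.aestronglyMeasurable] at ha hb ⊢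
  have hmid : IntegrableOn (fun x => ‖y x‖ ^ 2) (Icc b a) :=
    (hy.norm.pow 2).continuousOn.integrableOn_compact isCompact_Icc
  have hcover : (univ : Set ℝ) = Iio b ∪ (Icc b a ∪ Ioi a) := by
    ext x
    simp only [mem_univ, mem_union, mem_Iio, mem_Icc, mem_Ioi, true_iff]
    grind
  rw [← integrableOn_univ, hcover]
  exact IntegrableOn.union hb (hmid.union ha)

theorem IsSolution.mem_maxDomain (htop : LimitCircleAtTop q) (hbot : LimitCircleAtBot q)
    (hy : IsSolution q l y) : y ∈ maxDomain q := by
  obtain ⟨a, ha⟩ := htop l y hy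
  obtain ⟨b, hb⟩ := hbot l y hy
  have h := memLp_two_of_continuous hy.1.differentiable.continuous ha hb
  exact ⟨hy.1, h, (memLp_congr_ae hy.2).2 (h.const_mul l)⟩

theorem IsSolution.im_eq_zero (hq : LocallyIntegrable q volume) (hy : IsSolution q 0 y)
    (h₀ : (y 0).im = 0) (h₁ : (deriv y 0).im = 0) (x : ℝ) : (y x).im = 0 := by
  have hconj : (fun x => conj (y x)) = y := by
    refine IsSolution.ext hq (by simpa only [map_zero] using hy.conj) hy ?_ ?_
    · rw [Complex.conj_eq_iff_im.2 h₀]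
    · exact (congrFun (deriv_conj y) 0).trans (Complex.conj_eq_iff_im.2 h₁)
  exact Complex.conj_eq_iff_im.1 (congrFun hconj x)

theorem IsSolution.even (hq : LocallyIntegrable q volume) (heven : ∀ᵐ x : ℝ, q (-x) = q x)
    (hy : IsSolution q l y) (h : deriv y 0 = 0) (x : ℝ) : y (-x) = y x :=
  congrFun (IsSolution.ext hq (hy.comp_neg heven) hy (by rw [neg_zero])
    (by rw [deriv_comp_neg, neg_zero, h, neg_zero])) x

theorem IsSolution.odd (hq : LocallyIntegrable q volume) (heven : ∀ᵐ x : ℝ, q (-x) = q x)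
    (hy : IsSolution q l y) (h : y 0 = 0) (x : ℝ) : y (-x) = -y x := by
  have hneg : deriv ((-1 : ℂ) • y) 0 = -deriv y 0 := by
    rw [deriv_const_smul _ (hy.1.differentiable 0), neg_one_smul]
  have := congrFun (IsSolution.ext hq (hy.comp_neg heven) (hy.smul (-1)) (by simp [h])
    (by rw [deriv_comp_neg, neg_zero, hneg])) x
  simpa using this

theorem tendsto_bracket_self_of_real (h : ∀ x, (y x).im = 0) (F : Filter ℝ) :
    Tendsto (bracket y y) F (𝓝 0) := by
  rw [bracket_of_real h, funext (wronskian_self y)]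
  exact tendsto_const_nhds

theorem exists_isBoundaryPair (hq : LocallyIntegrable q volume)
    (heven : ∀ᵐ x : ℝ, q (-x) = q x) (htop : LimitCircleAtTop q) (hbot : LimitCircleAtBot q) :
    ∃ w₁ w₂ : ℝ → ℂ, IsBoundaryPair q w₁ w₂ := by
  obtain ⟨w₁, h₁, h₁₀, h₁₁⟩ := exists_isSolution hq 0 0 (-1)
  obtain ⟨w₂, h₂, h₂₀, h₂₁⟩ := exists_isSolution hq 0 1 0
  have hreal₁ := h₁.im_eq_zero hq (by simp [h₁₀]) (by simp [h₁₁])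
  have hreal₂ := h₂.im_eq_zero hq (by simp [h₂₀]) (by simp [h₂₁])
  have hone (F : Filter ℝ) : Tendsto (bracket w₁ w₂) F (𝓝 1) := by
    have hpair := IsFundamentalPair.of_initial_values h₁ h₂
      (by simp [wronskian, h₁₀, h₁₁, h₂₀, h₂₁])
    rw [bracket_of_real hreal₁, funext hpair.wronskian_eq_one]
    exact tendsto_const_nhds
  exact ⟨w₁, w₂, {
    mem₁ := h₁.mem_maxDomain htop hbot
    mem₂ := h₂.mem_maxDomain htop hbot
    sol₁ := h₁
    sol₂ := h₂
    real₁ := hreal₁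
    real₂ := hreal₂
    odd₁ := h₁.odd hq heven h₁₀
    even₂ := h₂.even hq heven h₂₁
    bot₁₂ := hone atBot
    top₁₂ := hone atTop
    bot₁₁ := tendsto_bracket_self_of_real hreal₁ atBot
    top₁₁ := tendsto_bracket_self_of_real hreal₁ atTop
    bot₂₂ := tendsto_bracket_self_of_real hreal₂ atBot
    top₂₂ := tendsto_bracket_self_of_real hreal₂ atTop }⟩

theorem IsBoundaryPair.isFundamentalPair (hw : IsBoundaryPair q w₁ w₂) :
    IsFundamentalPair q w₁ w₂ := by
  refine .of_initial_values hw.sol₁ hw.sol₂ ?_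
  have hconst : bracket w₁ w₂ = fun _ => wronskian w₁ w₂ 0 := by
    rw [bracket_of_real hw.real₁]
    exact funext fun x => hw.sol₁.wronskian_eq hw.sol₂ x 0
  exact tendsto_nhds_unique tendsto_const_nhds (hconst ▸ hw.top₁₂)

end BoundaryPair

section VariationOfConstants

variable {q : ℝ → ℝ} {w₁ w₂ : ℝ → ℂ}

theorem integral_eq_zero_of_notMem_Ioc {E : Type*} [NormedAddCommGroup E] [NormedSpace ℝ E]
    {g : ℝ → E} {a b x : ℝ} (hg : ∀ t ∉ Ioc a b, g t = 0) (hint : ∫ t, g t = 0)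
    (hx : x ∉ Ioc a b) : ∫ t in a..x, g t = 0 := by
  rcases le_or_gt x a with hxa | hax
  · rw [intervalIntegral.integral_of_ge hxa, setIntegral_eq_zero_of_forall_eq_zero, neg_zero]
    exact fun t ht => hg t fun ht' => ht'.1.not_ge ht.2
  · have hbx : b < x := not_le.1 fun hxb => hx ⟨hax, hxb⟩
    rw [intervalIntegral.integral_of_le hax.le,
      setIntegral_eq_integral_of_forall_compl_eq_zero, hint]
    exact fun t ht => hg t fun ht' => ht ⟨ht'.1, ht'.2.trans hbx.le⟩

namespace IsFundamentalPair

/-- The solution of `τ_q y = f` with `y c = y' c = 0` that variation of constants builds from a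
fundamental pair. -/
def particularSolution (w₁ w₂ f : ℝ → ℂ) (c x : ℝ) : ℂ :=
  w₁ x * (∫ t in c..x, w₂ t * f t) - w₂ x * ∫ t in c..x, w₁ t * f t

theorem isRegular_particularSolution (hw : IsFundamentalPair q w₁ w₂) {f : ℝ → ℂ}
    (hf : LocallyIntegrable f volume) (c : ℝ) :
    IsRegular (particularSolution w₁ w₂ f c) ∧
      tau q (particularSolution w₁ w₂ f c) =ᵐ[volume] f := by
  have hlocal {w : ℝ → ℂ} (h : IsSolution q 0 w) : LocallyIntegrable (fun t => w t * f t) volume :=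
    hf.continuous_mul h.1.differentiable.continuous
  have hF {w : ℝ → ℂ} (h : IsSolution q 0 w) := ACLoc.integral (hlocal h) c
  have hdF {w : ℝ → ℂ} (h : IsSolution q 0 w) := LocallyIntegrable.ae_hasDerivAt_integral (hlocal h)
  set v : ℝ → ℂ := fun x =>
    deriv w₁ x * (∫ t in c..x, w₂ t * f t) - deriv w₂ x * ∫ t in c..x, w₁ t * f t
  have hv : ACLoc v :=
    (hw.sol₁.1.acLoc_deriv.mul (hF hw.sol₂)).sub (hw.sol₂.1.acLoc_deriv.mul (hF hw.sol₁))
  have hu : ∀ x, HasDerivAt (particularSolution w₁ w₂ f c) (v x) x := by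
    refine ((hw.sol₁.1.acLoc.mul (hF hw.sol₂)).sub
      (hw.sol₂.1.acLoc.mul (hF hw.sol₁))).hasDerivAt_of_continuous ?_ hv.continuous
    filter_upwards [hdF hw.sol₁, hdF hw.sol₂] with x h₁ h₂
    refine (((hw.sol₁.1.differentiable x).hasDerivAt.mul (h₂ c)).sub
      ((hw.sol₂.1.differentiable x).hasDerivAt.mul (h₁ c))).congr_deriv ?_
    ring
  refine ⟨IsRegular.of_hasDerivAt hu hv, ?_⟩
  filter_upwards [hdF hw.sol₁, hdF hw.sol₂, hw.sol₁.1.ae_hasDerivAt_deriv q,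
    hw.sol₂.1.ae_hasDerivAt_deriv q, hw.sol₁.2, hw.sol₂.2] with x h₁ h₂ h₁' h₂' htau₁ htau₂
  have hv' : deriv v x = _ := ((h₁'.mul (h₂ c)).sub (h₂'.mul (h₁ c))).deriv
  have hone := hw.wronskian_eq_one x
  rw [wronskian] at hone
  rw [tau, funext fun x => (hu x).deriv, hv', particularSolution, htau₁, htau₂]
  linear_combination f x * hone

theorem exists_compactDomain_tau_eq (hw : IsFundamentalPair q w₁ w₂) {f : ℝ → ℂ}
    (hf : MemLp f 2 volume) (hsupp : HasCompactSupport f) (h₁ : ∫ x, w₁ x * f x = 0)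
    (h₂ : ∫ x, w₂ x * f x = 0) : ∃ y ∈ compactDomain q, tau q y =ᵐ[volume] f := by
  obtain ⟨a, b, hab⟩ : ∃ a b, ∀ x ∉ Ioc a b, f x = 0 := by
    obtain ⟨R, hR⟩ := hsupp.isCompact.isBounded.subset_closedBall 0
    rw [Real.closedBall_eq_Icc, zero_sub, zero_add] at hR
    refine ⟨-R - 1, R, fun x hx => image_eq_zero_of_notMem_tsupport fun hx' => hx ?_⟩
    exact ⟨by linarith [(hR hx').1], (hR hx').2⟩
  obtain ⟨hreg, htau⟩ := hw.isRegular_particularSolution (hf.locallyIntegrable (by norm_num)) a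
  have hcompact : HasCompactSupport (particularSolution w₁ w₂ f a) := by
    refine HasCompactSupport.intro (isCompact_Icc (a := a) (b := b)) fun x hx => ?_
    have hvanish {w : ℝ → ℂ} (hwf : ∫ x, w x * f x = 0) : ∫ t in a..x, w t * f t = 0 :=
      integral_eq_zero_of_notMem_Ioc (fun t ht => by rw [hab t ht, mul_zero]) hwf
        fun hx' => hx (Ioc_subset_Icc_self hx')
    rw [particularSolution, hvanish h₁, hvanish h₂, mul_zero, mul_zero, sub_zero]
  exact ⟨⟨_, hreg, hreg.differentiable.continuous.memLp_of_hasCompactSupport hcompact,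
    (memLp_congr_ae htau).2 hf⟩, hcompact, htau⟩

end IsFundamentalPair

end VariationOfConstants

section Green

variable {q : ℝ → ℝ} (f g : maxDomain q)

theorem integrable_conj_mul {f g : ℝ → ℂ} (hf : MemLp f 2 volume) (hg : MemLp g 2 volume) :
    Integrable (fun x => conj (f x) * g x) volume :=
  MemLp.integrable_mul (p := 2) (q := 2) hf.star hg

theorem inner_toLp {f g : ℝ → ℂ} (hf : MemLp f 2 volume) (hg : MemLp g 2 volume) :
    inner ℂ (hf.toLp f) (hg.toLp g) = ∫ x, conj (f x) * g x := by
  rw [L2.inner_def]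
  refine integral_congr_ae ?_
  filter_upwards [hf.coeFn_toLp, hg.coeFn_toLp] with x hfx hgx
  rw [hfx, hgx, RCLike.inner_apply, mul_comm]

theorem inner_toLp_right (g : L2) {f : ℝ → ℂ} (hf : MemLp f 2 volume) :
    inner ℂ g (hf.toLp f) = ∫ x, conj (g x) * f x := by
  conv_lhs => rw [← Lp.toLp_coeFn g (Lp.memLp g)]
  exact inner_toLp _ hf

theorem inner_toL2 (g : L2) (y : maxDomain q) :
    inner ℂ g (toL2 q y) = ∫ x, conj (g x) * (y : ℝ → ℂ) x :=
  inner_toLp_right g y.2.2.1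

theorem inner_tauL2 (g : L2) (y : maxDomain q) :
    inner ℂ g (tauL2 q y) = ∫ x, conj (g x) * tau q y x :=
  inner_toLp_right g y.2.2.2

theorem integrable_lagrange :
    Integrable (fun x => conj (tau q f x) * (g : ℝ → ℂ) x - conj ((f : ℝ → ℂ) x) * tau q g x)
      volume :=
  (integrable_conj_mul f.2.2.2 g.2.2.1).sub (integrable_conj_mul f.2.2.1 g.2.2.2)

theorem tendsto_bracketTop : Tendsto (bracket f g) atTop (𝓝 (bracketTop f g)) := by
  have h := intervalIntegral_tendsto_integral_Ioi 0 (integrable_lagrange f g).integrableOn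
    tendsto_id
  simp only [f.2.1.integral_lagrange q g.2.1, id] at h
  exact tendsto_nhds_limUnder ⟨_, (h.add_const (bracket f g 0)).congr fun x => sub_add_cancel _ _⟩

theorem tendsto_bracketBot : Tendsto (bracket f g) atBot (𝓝 (bracketBot f g)) := by
  have h := intervalIntegral_tendsto_integral_Iic 0 (integrable_lagrange f g).integrableOn
    tendsto_id
  simp only [f.2.1.integral_lagrange q g.2.1, id] at h
  exact tendsto_nhds_limUnder ⟨_, (h.const_sub (bracket f g 0)).congr fun x => sub_sub_cancel _ _⟩

theorem bracketTop_sub_bracketBot :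
    bracketTop f g - bracketBot f g =
      inner ℂ (tauL2 q f) (toL2 q g) - inner ℂ (toL2 q f) (tauL2 q g) := by
  have h := intervalIntegral_tendsto_integral (integrable_lagrange f g) tendsto_neg_atTop_atBot
    tendsto_id
  simp only [f.2.1.integral_lagrange q g.2.1, id] at h
  rw [integral_sub (integrable_conj_mul f.2.2.2 g.2.2.1) (integrable_conj_mul f.2.2.1 g.2.2.2),
    ← inner_toLp f.2.2.2 g.2.2.1, ← inner_toLp f.2.2.1 g.2.2.2] at h
  exact tendsto_nhds_unique
    ((tendsto_bracketTop f g).sub ((tendsto_bracketBot f g).comp tendsto_neg_atTop_atBot)) h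

end Green

section Annihilator

open scoped CompactlySupported

variable {E : Type*} [NormedAddCommGroup E] [MeasurableSpace E] [BorelSpace E] {μ : Measure E}
  {k : E → ℂ}

theorem integrable_mul_compactlySupported (hk : LocallyIntegrable k μ) (f : C_c(E, ℂ)) :
    Integrable (fun x => k x * f x) μ := by
  have h := hk.integrable_smul_left_of_hasCompactSupport f.continuous f.hasCompactSupport
  simp only [smul_eq_mul, mul_comm] at h ⊢
  exact h

/-- The distribution `f ↦ ∫ k f dμ` of a locally integrable function, on continuous compactly
supported test functions. -/
def integralAgainst (hk : LocallyIntegrable k μ) : C_c(E, ℂ) →ₗ[ℂ] ℂ where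
  toFun f := ∫ x, k x * f x ∂μ
  map_add' f g := by
    simp only [CompactlySupportedContinuousMap.coe_add, Pi.add_apply, mul_add]
    exact integral_add (integrable_mul_compactlySupported hk f)
      (integrable_mul_compactlySupported hk g)
  map_smul' c f := by
    simp only [CompactlySupportedContinuousMap.coe_smul, Pi.smul_apply, smul_eq_mul,
      RingHom.id_apply, mul_left_comm _ c, integral_const_mul]

variable [NormedSpace ℝ E] [FiniteDimensional ℝ E]

theorem ae_eq_zero_of_forall_integral_mul_eq_zero (hk : LocallyIntegrable k μ)
    (h : ∀ f : C_c(E, ℂ), ∫ x, k x * f x ∂μ = 0) : k =ᵐ[μ] 0 := by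
  refine ae_eq_zero_of_integral_contDiff_smul_eq_zero hk fun g hg hgsupp => ?_
  have := h ⟨⟨fun x => (g x : ℂ), by fun_prop⟩, hgsupp.comp_left Complex.ofReal_zero⟩
  simpa only [CompactlySupportedContinuousMap.coe_mk, ContinuousMap.coe_mk, mul_comm,
    Complex.real_smul] using this

theorem exists_ae_eq_sum_of_forall_integral_mul_eq_zero {ι : Type*} [Fintype ι] {w : ι → E → ℂ}
    (hw : ∀ i, LocallyIntegrable (w i) μ) (hk : LocallyIntegrable k μ)
    (h : ∀ f : C_c(E, ℂ), (∀ i, ∫ x, w i x * f x ∂μ = 0) → ∫ x, k x * f x ∂μ = 0) :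
    ∃ c : ι → ℂ, k =ᵐ[μ] fun x => ∑ i, c i * w i x := by
  have hker : ⨅ i, (integralAgainst (hw i)).ker ≤ (integralAgainst hk).ker := fun f hf =>
    h f fun i => (Submodule.mem_iInf _).1 hf i
  obtain ⟨c, hc⟩ := (Submodule.mem_span_range_iff_exists_fun ℂ).1
    (mem_span_of_iInf_ker_le_ker hker)
  have hsum : LocallyIntegrable (fun x => ∑ i, c i * w i x) μ :=
    locallyIntegrable_finsetSum _ fun i _ => (hw i).smul (c i)
  refine ⟨c, ?_⟩
  have hzero : (fun x => k x - ∑ i, c i * w i x) =ᵐ[μ] 0 := by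
    refine ae_eq_zero_of_forall_integral_mul_eq_zero (hk.sub hsum) fun f => ?_
    have hci (i : ι) : Integrable (fun x => c i * (w i x * f x)) μ :=
      (integrable_mul_compactlySupported (hw i) f).const_mul (c i)
    have hf : ∑ i, c i * ∫ x, w i x * f x ∂μ = ∫ x, k x * f x ∂μ := by
      simpa only [LinearMap.sum_apply, LinearMap.smul_apply, smul_eq_mul, integralAgainst,
        LinearMap.coe_mk, AddHom.coe_mk] using LinearMap.congr_fun hc f
    simp only [sub_mul, Finset.sum_mul, mul_assoc]
    rw [integral_sub (integrable_mul_compactlySupported hk f)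
      (integrable_finsetSum _ fun i _ => hci i), integral_finsetSum _ fun i _ => hci i,
      ← hf, sub_eq_zero]
    simp only [integral_const_mul]
  filter_upwards [hzero] with x hx
  exact sub_eq_zero.1 hx

end Annihilator

section WeakSolutions

variable {q : ℝ → ℝ} {u y w₁ w₂ : ℝ → ℂ}

theorem ACLoc.integrable_deriv_of_hasCompactSupport (hy : ACLoc y) (hsupp : HasCompactSupport y) :
    Integrable (deriv y) volume :=
  (integrableOn_iff_integrable_of_support_subset support_deriv_subset).1
    (hy.locallyIntegrable_deriv.integrableOn_isCompact hsupp)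

theorem ACLoc.integral_deriv_eq_zero (hy : ACLoc y) (hsupp : HasCompactSupport y) :
    ∫ x, deriv y x = 0 := by
  have hlim := intervalIntegral_tendsto_integral (hy.integrable_deriv_of_hasCompactSupport hsupp)
    tendsto_neg_atTop_atBot tendsto_id
  simp only [hy.integral_eq_sub (hy.ae_differentiableAt.mono fun _ hx => hx.hasDerivAt), id] at hlim
  have hzero : y =ᶠ[cocompact ℝ] 0 :=
    coclosedCompact_eq_cocompact (X := ℝ) ▸ hasCompactSupport_iff_eventuallyEq.1 hsupp
  refine tendsto_nhds_unique hlim (Tendsto.congr' ?_ tendsto_const_nhds)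
  filter_upwards [hzero.filter_mono atTop_le_cocompact,
    tendsto_neg_atTop_atBot.eventually (hzero.filter_mono atBot_le_cocompact)] with R hR hR'
  simp only [hR, hR', Pi.zero_apply, sub_zero]

theorem hasCompactSupport_wronskian (u : ℝ → ℂ) (hsupp : HasCompactSupport y) :
    HasCompactSupport (wronskian u y) :=
  (hsupp.deriv.mul_left (f := u)).sub (hsupp.mul_left (f := deriv u))

theorem IsRegular.integrable_mul_sub_mul_tau (q : ℝ → ℝ) (hu : IsRegular u) (hy : IsRegular y)
    (hsupp : HasCompactSupport y) :
    Integrable (fun x => tau q u x * y x - u x * tau q y x) volume :=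
  ((hu.acLoc_wronskian hy).integrable_deriv_of_hasCompactSupport
    (hasCompactSupport_wronskian u hsupp)).congr
      ((hu.ae_hasDerivAt_wronskian q hy).mono fun _ hx => hx.deriv)

theorem IsRegular.integral_mul_sub_mul_tau_eq_zero (q : ℝ → ℝ) (hu : IsRegular u)
    (hy : IsRegular y) (hsupp : HasCompactSupport y) :
    ∫ x, (tau q u x * y x - u x * tau q y x) = 0 := by
  rw [← (hu.acLoc_wronskian hy).integral_deriv_eq_zero (hasCompactSupport_wronskian u hsupp)]
  exact integral_congr_ae ((hu.ae_hasDerivAt_wronskian q hy).mono fun _ hx => hx.deriv.symm)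

theorem IsFundamentalPair.exists_isSolution_ae_eq (hw : IsFundamentalPair q w₁ w₂) {k : ℝ → ℂ}
    (hk : LocallyIntegrable k volume)
    (h : ∀ y ∈ compactDomain q, ∫ x, k x * tau q y x = 0) :
    ∃ v, IsSolution q 0 v ∧ k =ᵐ[volume] v := by
  have hloc (i : Fin 2) : LocallyIntegrable (![w₁, w₂] i) volume := by
    fin_cases i
    · exact hw.sol₁.1.differentiable.continuous.locallyIntegrable
    · exact hw.sol₂.1.differentiable.continuous.locallyIntegrable
  obtain ⟨c, hc⟩ := exists_ae_eq_sum_of_forall_integral_mul_eq_zero hloc hk fun f hf => by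
    obtain ⟨y, hy, hyf⟩ := hw.exists_compactDomain_tau_eq
      (f.continuous.memLp_of_hasCompactSupport f.hasCompactSupport) f.hasCompactSupport
      (hf 0) (hf 1)
    rw [← h y hy]
    exact integral_congr_ae (hyf.mono fun x hx => congrArg (k x * ·) hx.symm)
  refine ⟨c 0 • w₁ + c 1 • w₂, (hw.sol₁.smul _).add (hw.sol₂.smul _), hc.trans (.of_eq ?_)⟩
  ext x
  rw [Fin.sum_univ_two]
  rfl

theorem integral_conj_sub_mul_tau_eq_zero {g h : L2} (hu : IsRegular u)
    (hτu : tau q u =ᵐ[volume] h) {y : maxDomain q} (hy : y ∈ compactDomain q)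
    (H : inner ℂ g (tauL2 q y) = inner ℂ h (toL2 q y)) :
    ∫ x, (conj (g x) - conj (u x)) * tau q y x = 0 := by
  have hgy := integrable_conj_mul (Lp.memLp g) y.2.2.2
  have hhy := integrable_conj_mul (Lp.memLp h) y.2.2.1
  rw [inner_tauL2, inner_toL2] at H
  calc ∫ x, (conj (g x) - conj (u x)) * tau q y x
    _ = ∫ x, ((conj (g x) * tau q y x - conj (h x) * (y : ℝ → ℂ) x) +
        (tau q (fun x => conj (u x)) x * (y : ℝ → ℂ) x - conj (u x) * tau q y x)) := by
      refine integral_congr_ae (hτu.mono fun x hx => ?_)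
      simp only [tau_conj, hx]
      ring
    _ = (∫ x, (conj (g x) * tau q y x - conj (h x) * (y : ℝ → ℂ) x)) + 0 := by
      rw [← hu.conj.integral_mul_sub_mul_tau_eq_zero q y.2.1 hy]
      exact integral_add (hgy.sub hhy) (hu.conj.integrable_mul_sub_mul_tau q y.2.1 hy)
    _ = 0 := by
      rw [integral_sub hgy hhy, H, sub_self, add_zero]

theorem exists_maxDomain_of_forall_inner_eq (hq : LocallyIntegrable q volume) {g h : L2}
    (H : ∀ y ∈ compactDomain q, inner ℂ g (tauL2 q y) = inner ℂ h (toL2 q y)) :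
    ∃ z : maxDomain q, toL2 q z = g ∧ tauL2 q z = h := by
  obtain ⟨w₁, w₂, hw⟩ := exists_isFundamentalPair hq
  have hg := Lp.memLp g
  have hh := Lp.memLp h
  obtain ⟨u, hu, hτu⟩ : ∃ u, IsRegular u ∧ tau q u =ᵐ[volume] h :=
    ⟨_, hw.isRegular_particularSolution (hh.locallyIntegrable (by norm_num)) 0⟩
  obtain ⟨v, hv, hgu⟩ := hw.exists_isSolution_ae_eq
    ((hg.star.locallyIntegrable (by norm_num)).sub
      hu.conj.differentiable.continuous.locallyIntegrable)
    fun y hy => integral_conj_sub_mul_tau_eq_zero hu hτu hy (H y hy)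
  have hvconj : IsSolution q 0 fun x => conj (v x) := by simpa only [map_zero] using hv.conj
  have hz : u + (fun x => conj (v x)) =ᵐ[volume] g := by
    filter_upwards [hgu] with x hx
    rw [Pi.add_apply, ← hx, Pi.sub_apply, Pi.star_apply, ← starRingEnd_apply, map_sub,
      Complex.conj_conj, Complex.conj_conj, add_sub_cancel]
  have hτz : tau q (u + fun x => conj (v x)) =ᵐ[volume] h := by
    filter_upwards [tau_add q hu hvconj.1, hτu, hvconj.2] with x hadd hux hvx
    rw [hadd, Pi.add_apply, hux, hvx, zero_mul, add_zero]
  have hzg := (memLp_congr_ae hz).2 hg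
  have hτzh := (memLp_congr_ae hτz).2 hh
  exact ⟨⟨_, hu.add hvconj.1, hzg, hτzh⟩,
    ((MemLp.toLp_eq_toLp_iff hzg hg).2 hz).trans (Lp.toLp_coeFn g hg),
    ((MemLp.toLp_eq_toLp_iff hτzh hh).2 hτz).trans (Lp.toLp_coeFn h hh)⟩

end WeakSolutions

section GraphAdjoint

variable {𝕜 E F : Type*} [RCLike 𝕜] [NormedAddCommGroup E] [InnerProductSpace 𝕜 E]
  [NormedAddCommGroup F] [InnerProductSpace 𝕜 F] {G : Submodule 𝕜 (E × F)}

theorem mem_adjoint_iff_inner_eq {p : F × E} :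
    p ∈ G.adjoint ↔ ∀ a b, (a, b) ∈ G → inner 𝕜 p.1 b = inner 𝕜 p.2 a := by
  rw [Submodule.mem_adjoint_iff]
  refine forall₃_congr fun a b _ => ?_
  rw [sub_eq_zero, ← inner_conj_symm b, ← inner_conj_symm a, RingHom.injective _ |>.eq_iff]

theorem isClosed_adjoint (G : Submodule 𝕜 (E × F)) : IsClosed (G.adjoint : Set (F × E)) := by
  have h : (G.adjoint : Set (F × E)) =
      ⋂ z : G, {p | inner 𝕜 p.1 z.1.2 = inner 𝕜 p.2 z.1.1} := by
    ext p
    simp only [SetLike.mem_coe, mem_adjoint_iff_inner_eq, mem_iInter, mem_ofPred_eq,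
      Subtype.forall, Prod.forall]
  rw [h]
  exact isClosed_iInter fun z => isClosed_eq (by fun_prop) (by fun_prop)

theorem le_adjoint_adjoint : G ≤ G.adjoint.adjoint := fun p hp =>
  mem_adjoint_iff_inner_eq.2 fun a b hab => by
    rw [← inner_conj_symm, ← mem_adjoint_iff_inner_eq.1 hab p.1 p.2 hp, inner_conj_symm]

theorem adjoint_adjoint [CompleteSpace E] [CompleteSpace F] :
    G.adjoint.adjoint = G.topologicalClosure := by
  refine le_antisymm (fun p hp => ?_)
    (G.topologicalClosure_minimal le_adjoint_adjoint (isClosed_adjoint _))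
  let e := WithLp.linearEquiv 2 𝕜 (E × F)
  let H : Submodule 𝕜 (WithLp 2 (E × F)) := G.map e.symm.toLinearMap
  have hbiorth : e.symm p ∈ Hᗮᗮ := by
    rw [Submodule.mem_orthogonal]
    intro x hx
    have hskew : ((e x).2, -(e x).1) ∈ G.adjoint := mem_adjoint_iff_inner_eq.2 fun a b hab => by
      have h := (Submodule.mem_orthogonal' _ _).1 hx (e.symm (a, b)) (Submodule.mem_map_of_mem hab)
      rw [WithLp.prod_inner_apply, add_comm] at h
      rw [inner_neg_left]
      exact eq_neg_of_add_eq_zero_left h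
    have h := (Submodule.mem_adjoint_iff _ _).1 hp _ _ hskew
    rw [inner_neg_left, ← neg_add', neg_eq_zero] at h
    rwa [WithLp.prod_inner_apply]
  rw [Submodule.orthogonal_orthogonal_eq_closure] at hbiorth
  have himage : e '' H = G := by
    change e '' (e.symm '' G) = G
    rw [image_image]
    simp only [LinearEquiv.apply_symm_apply, image_id']
  rw [← SetLike.mem_coe, Submodule.topologicalClosure_coe, ← himage]
  exact image_closure_subset_closure_image (WithLp.prod_continuous_ofLp 2 E F)
    ⟨e.symm p, hbiorth, e.apply_symm_apply p⟩

end GraphAdjoint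

section Operators

variable {q : ℝ → ℝ}

theorem maxOp_apply (y : maxDomain q) (h : toL2 q y ∈ (maxOp q).domain) :
    maxOp q ⟨toL2 q y, h⟩ = tauL2 q y :=
  congrArg (tauL2 q) ((LinearEquiv.ofInjective (toL2 q) (toL2_injective q)).symm_apply_apply y)

theorem apply_toL2_of_le_maxOp {T : L2 →ₗ.[ℂ] L2} (hT : T ≤ maxOp q) (y : maxDomain q)
    (h : toL2 q y ∈ T.domain) : T ⟨toL2 q y, h⟩ = tauL2 q y :=
  (hT.2 (y := ⟨toL2 q y, hT.1 h⟩) rfl).trans (maxOp_apply y _)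

theorem mem_graph_iff_of_le_maxOp {T : L2 →ₗ.[ℂ] L2} (hT : T ≤ maxOp q) {p : L2 × L2} :
    p ∈ T.graph ↔ ∃ y : maxDomain q, toL2 q y ∈ T.domain ∧ (toL2 q y, tauL2 q y) = p := by
  rw [LinearPMap.mem_graph_iff']
  constructor
  · rintro ⟨⟨f, hf⟩, rfl⟩
    obtain ⟨y, rfl⟩ := hT.1 hf
    exact ⟨y, hf, by rw [apply_toL2_of_le_maxOp hT]⟩
  · rintro ⟨y, hy, rfl⟩
    exact ⟨⟨toL2 q y, hy⟩, by rw [apply_toL2_of_le_maxOp hT]⟩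

theorem toL2_mem_domain_iff {T : L2 →ₗ.[ℂ] L2} (hT : T ≤ maxOp q) (y : maxDomain q) :
    toL2 q y ∈ T.domain ↔ (toL2 q y, tauL2 q y) ∈ T.graph :=
  ⟨fun h => (mem_graph_iff_of_le_maxOp hT).2 ⟨y, h, rfl⟩, LinearPMap.mem_domain_of_mem_graph⟩

theorem mem_maxOp_graph {p : L2 × L2} :
    p ∈ (maxOp q).graph ↔ ∃ y : maxDomain q, (toL2 q y, tauL2 q y) = p :=
  (mem_graph_iff_of_le_maxOp le_rfl).trans
    (exists_congr fun y => and_iff_right (LinearMap.mem_range_self _ y))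

theorem preMinOp_le_maxOp : preMinOp q ≤ maxOp q := LinearPMap.domRestrict_le

theorem toL2_mem_preMinOp_domain_iff {y : maxDomain q} :
    toL2 q y ∈ (preMinOp q).domain ↔ y ∈ compactDomain q := by
  constructor
  · rintro ⟨⟨z, hz, hzy⟩, -⟩
    exact toL2_injective q hzy ▸ hz
  · exact fun hy => ⟨⟨y, hy, rfl⟩, y, rfl⟩

theorem mem_preMinOp_graph {p : L2 × L2} :
    p ∈ (preMinOp q).graph ↔ ∃ y ∈ compactDomain q, (toL2 q y, tauL2 q y) = p := by
  simp only [mem_graph_iff_of_le_maxOp preMinOp_le_maxOp, toL2_mem_preMinOp_domain_iff]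

theorem inner_toL2_tauL2_of_mem_compactDomain (u : maxDomain q) {y : maxDomain q}
    (hy : y ∈ compactDomain q) :
    inner ℂ (toL2 q u) (tauL2 q y) = inner ℂ (tauL2 q u) (toL2 q y) := by
  have hzero := u.2.1.conj.integral_mul_sub_mul_tau_eq_zero q y.2.1 hy
  simp only [tau_conj] at hzero
  rw [integral_sub (integrable_conj_mul u.2.2.2 y.2.2.1) (integrable_conj_mul u.2.2.1 y.2.2.2),
    ← inner_toLp u.2.2.2 y.2.2.1, ← inner_toLp u.2.2.1 y.2.2.2, sub_eq_zero] at hzero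
  exact hzero.symm

variable (hq : LocallyIntegrable q volume)
include hq

theorem dense_preMinOp_domain : Dense ((preMinOp q).domain : Set L2) := by
  rw [Submodule.dense_iff_topologicalClosure_eq_top, Submodule.topologicalClosure_eq_top_iff,
    Submodule.eq_bot_iff]
  intro h hh
  rw [Submodule.mem_orthogonal'] at hh
  obtain ⟨u, hu, rfl⟩ := exists_maxDomain_of_forall_inner_eq hq (g := 0) (h := h) fun y hy => by
    rw [hh _ (toL2_mem_preMinOp_domain_iff.2 hy), inner_zero_left]
  rw [toL2_injective q (hu.trans (map_zero _).symm), map_zero]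

theorem adjoint_preMinOp_graph : (preMinOp q).graph.adjoint = (maxOp q).graph := by
  ext ⟨g, h⟩
  rw [mem_adjoint_iff_inner_eq, mem_maxOp_graph]
  constructor
  · intro H
    obtain ⟨z, rfl, rfl⟩ := exists_maxDomain_of_forall_inner_eq hq fun y hy =>
      H _ _ (mem_preMinOp_graph.2 ⟨y, hy, rfl⟩)
    exact ⟨z, rfl⟩
  · rintro ⟨u, hu⟩ a b hab
    obtain ⟨y, hy, hab⟩ := mem_preMinOp_graph.1 hab
    obtain ⟨rfl, rfl⟩ := Prod.mk.inj hu
    obtain ⟨rfl, rfl⟩ := Prod.mk.inj hab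
    exact inner_toL2_tauL2_of_mem_compactDomain u hy

theorem isClosed_maxOp : (maxOp q).IsClosed := by
  rw [LinearPMap.IsClosed, ← adjoint_preMinOp_graph hq]
  exact isClosed_adjoint _

theorem minOp_graph : (minOp q).graph = (maxOp q).graph.adjoint := by
  rw [← adjoint_preMinOp_graph hq, adjoint_adjoint]
  exact (((isClosed_maxOp hq).isClosable.leIsClosable
    preMinOp_le_maxOp).graph_closure_eq_closure_graph).symm

theorem minOp_le_maxOp : minOp q ≤ maxOp q := by
  refine LinearPMap.le_of_le_graph ?_
  rw [minOp_graph hq, ← adjoint_preMinOp_graph hq, adjoint_adjoint]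
  exact Submodule.topologicalClosure_minimal _
    (adjoint_preMinOp_graph hq ▸ LinearPMap.le_graph_of_le preMinOp_le_maxOp) (isClosed_adjoint _)

theorem dense_minOp_domain : Dense ((minOp q).domain : Set L2) :=
  (dense_preMinOp_domain hq).mono (LinearPMap.le_closure _).1

theorem adjoint_minOp : (minOp q).adjoint = maxOp q := by
  apply LinearPMap.eq_of_eq_graph
  rw [LinearPMap.adjoint_graph_eq_graph_adjoint (dense_minOp_domain hq), minOp_graph hq,
    adjoint_adjoint, (isClosed_maxOp hq).submodule_topologicalClosure_eq]

theorem toL2_mem_minOp_domain_iff {y : maxDomain q} :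
    toL2 q y ∈ (minOp q).domain ↔ ∀ z : maxDomain q, bracketTop z y - bracketBot z y = 0 := by
  rw [toL2_mem_domain_iff (minOp_le_maxOp hq), minOp_graph hq, Submodule.mem_adjoint_iff]
  simp only [bracketTop_sub_bracketBot]
  constructor
  · exact fun H z => H _ _ (mem_maxOp_graph.2 ⟨z, rfl⟩)
  · intro H a b hab
    obtain ⟨z, hz⟩ := mem_maxOp_graph.1 hab
    obtain ⟨rfl, rfl⟩ := Prod.mk.inj hz
    exact H z

end Operators

section Cutoff

variable {q : ℝ → ℝ} {φ y : ℝ → ℂ}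

theorem contDiff_one_deriv (hφ : ContDiff ℝ 2 φ) : ContDiff ℝ 1 (deriv φ) :=
  ((contDiff_succ_iff_deriv (n := 1)).1 hφ).2.2

theorem IsRegular.hasDerivAt_mul_left (hφ : ContDiff ℝ 2 φ) (hy : IsRegular y) (x : ℝ) :
    HasDerivAt (fun x => φ x * y x) (deriv φ x * y x + φ x * deriv y x) x :=
  (hφ.differentiable two_ne_zero x).hasDerivAt.mul (hy.differentiable x).hasDerivAt

theorem IsRegular.mul_left (hφ : ContDiff ℝ 2 φ) (hy : IsRegular y) :
    IsRegular fun x => φ x * y x :=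
  IsRegular.of_hasDerivAt (hy.hasDerivAt_mul_left hφ)
    (((ACLoc.of_contDiff (contDiff_one_deriv hφ)).mul hy.acLoc).add
      ((ACLoc.of_contDiff (hφ.of_le one_le_two)).mul hy.acLoc_deriv))

theorem IsRegular.tau_mul_left (q : ℝ → ℝ) (hφ : ContDiff ℝ 2 φ) (hy : IsRegular y) :
    tau q (fun x => φ x * y x) =ᵐ[volume] fun x =>
      φ x * tau q y x - (deriv (deriv φ) x * y x + 2 * deriv φ x * deriv y x) := by
  have hderiv : (deriv fun x => φ x * y x) = fun x => deriv φ x * y x + φ x * deriv y x :=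
    funext fun x => (hy.hasDerivAt_mul_left hφ x).deriv
  filter_upwards [hy.acLoc_deriv.ae_differentiableAt] with x hx
  have hφ' := ((contDiff_one_deriv hφ).differentiable one_ne_zero x).hasDerivAt
  have hderiv₂ := ((hφ'.mul (hy.differentiable x).hasDerivAt).add
    ((hφ.differentiable two_ne_zero x).hasDerivAt.mul hx.hasDerivAt)).deriv
  rw [tau, hderiv, tau]
  linear_combination -hderiv₂

theorem mul_mem_maxDomain (hφ : ContDiff ℝ 2 φ) {C : ℝ} (hC : ∀ x, ‖φ x‖ ≤ C)
    (hsupp : HasCompactSupport (deriv φ)) (hy : y ∈ maxDomain q) :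
    (fun x => φ x * y x) ∈ maxDomain q := by
  obtain ⟨hreg, hyL2, hτL2⟩ := hy
  have hmul {f : ℝ → ℂ} (hf : MemLp f 2 volume) : MemLp (fun x => φ x * f x) 2 volume :=
    hf.of_le_mul (hφ.continuous.aestronglyMeasurable.mul hf.1) <| ae_of_all _ fun x => by
      rw [norm_mul]
      exact mul_le_mul_of_nonneg_right (hC x) (norm_nonneg _)
  have hcont : Continuous y := hreg.differentiable.continuous
  have hcont' : Continuous (deriv y) := hreg.acLoc_deriv.continuous
  have hφ' : Continuous (deriv φ) := (contDiff_one_deriv hφ).continuous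
  have : Continuous (deriv (deriv φ)) := (contDiff_one_deriv hφ).continuous_deriv le_rfl
  have hcommutator : MemLp (fun x => deriv (deriv φ) x * y x + 2 * deriv φ x * deriv y x) 2
      volume :=
    Continuous.memLp_of_hasCompactSupport (by fun_prop) ((hsupp.deriv.mul_right (f' := y)).add
      ((hsupp.mul_left (f := fun _ => 2)).mul_right (f' := deriv y)))
  exact ⟨hreg.mul_left hφ, hmul hyL2,
    (memLp_congr_ae (hreg.tau_mul_left q hφ)).2 ((hmul hτL2).sub hcommutator)⟩

theorem exists_contDiff_cutoff : ∃ φ : ℝ → ℂ, ContDiff ℝ 2 φ ∧ (∀ x, ‖φ x‖ ≤ 1) ∧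
    HasCompactSupport (deriv φ) ∧ EqOn φ 0 (Iio 0) ∧ EqOn φ 1 (Ioi 1) := by
  let φ : ℝ → ℂ := fun x => (Real.smoothTransition x : ℂ)
  have hzero : EqOn φ 0 (Iio 0) := fun x hx =>
    congrArg Complex.ofReal (Real.smoothTransition.zero_of_nonpos (mem_Iio.1 hx).le)
  have hone : EqOn φ 1 (Ioi 1) := fun x hx =>
    congrArg Complex.ofReal (Real.smoothTransition.one_of_one_le (mem_Ioi.1 hx).le)
  refine ⟨φ, Complex.ofRealCLM.contDiff.comp Real.smoothTransition.contDiff, fun x => ?_,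
    .intro (isCompact_Icc (a := 0) (b := 1)) fun x hx => ?_, hzero, hone⟩
  · rw [Complex.norm_real, Real.norm_of_nonneg (Real.smoothTransition.nonneg x)]
    exact Real.smoothTransition.le_one x
  · rw [mem_Icc, not_and_or, not_le, not_le] at hx
    rcases hx with hx | hx
    · rw [hzero.deriv isOpen_Iio hx]
      exact deriv_const x 0
    · rw [hone.deriv isOpen_Ioi hx]
      exact deriv_const x 1

theorem exists_maxDomain_cutoff (y : maxDomain q) :
    ∃ z : maxDomain q, EqOn (z : ℝ → ℂ) 0 (Iio 0) ∧ EqOn (z : ℝ → ℂ) y (Ioi 1) := by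
  obtain ⟨φ, hφ, hbound, hsupp, hzero, hone⟩ := exists_contDiff_cutoff
  refine ⟨⟨_, mul_mem_maxDomain hφ hbound hsupp y.2⟩, fun x hx => ?_, fun x hx => ?_⟩
  · exact mul_eq_zero_of_left (hzero hx) _
  · exact (congrArg (· * (y : ℝ → ℂ) x) (hone hx)).trans (one_mul _)

end Cutoff

section BracketFunctionals

variable {q : ℝ → ℝ} {f g : ℝ → ℂ}

theorem bracket_eqOn (w : ℝ → ℂ) {s : Set ℝ} (hs : IsOpen s) (h : EqOn f g s) :
    EqOn (bracket w f) (bracket w g) s := fun x hx => by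
  rw [bracket, bracket, h.deriv hs hx, h hx]

theorem bracketTop_congr (w : ℝ → ℂ) {a : ℝ} (h : EqOn f g (Ioi a)) :
    bracketTop w f = bracketTop w g :=
  congrArg lim <| Filter.map_congr <|
    (eventually_gt_atTop a).mono (bracket_eqOn w isOpen_Ioi h)

theorem bracketBot_congr (w : ℝ → ℂ) {a : ℝ} (h : EqOn f g (Iio a)) :
    bracketBot w f = bracketBot w g :=
  congrArg lim <| Filter.map_congr <|
    (eventually_lt_atBot a).mono (bracket_eqOn w isOpen_Iio h)

theorem bracket_add (w : ℝ → ℂ) (hf : IsRegular f) (hg : IsRegular g) (x : ℝ) :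
    bracket w (f + g) x = bracket w f x + bracket w g x := by
  simp only [bracket, deriv_add (hf.differentiable x) (hg.differentiable x), Pi.add_apply]
  ring

theorem bracket_smul (w : ℝ → ℂ) (c : ℂ) (hf : IsRegular f) (x : ℝ) :
    bracket w (c • f) x = c * bracket w f x := by
  simp only [bracket, deriv_const_smul c (hf.differentiable x), Pi.smul_apply, smul_eq_mul]
  ring

/-- `f ↦ [w,f]_∞` as a linear functional on the maximal domain. -/
def bracketTopLM (w : maxDomain q) : maxDomain q →ₗ[ℂ] ℂ where
  toFun f := bracketTop w f
  map_add' f g := tendsto_nhds_unique (tendsto_bracketTop w (f + g))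
    (((tendsto_bracketTop w f).add (tendsto_bracketTop w g)).congr fun x =>
      (bracket_add _ f.2.1 g.2.1 x).symm)
  map_smul' c f := tendsto_nhds_unique (tendsto_bracketTop w (c • f))
    (((tendsto_bracketTop w f).const_mul c).congr fun x => (bracket_smul _ c f.2.1 x).symm)

/-- `f ↦ [w,f]_{-∞}` as a linear functional on the maximal domain. -/
def bracketBotLM (w : maxDomain q) : maxDomain q →ₗ[ℂ] ℂ where
  toFun f := bracketBot w f
  map_add' f g := tendsto_nhds_unique (tendsto_bracketBot w (f + g))
    (((tendsto_bracketBot w f).add (tendsto_bracketBot w g)).congr fun x =>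
      (bracket_add _ f.2.1 g.2.1 x).symm)
  map_smul' c f := tendsto_nhds_unique (tendsto_bracketBot w (c • f))
    (((tendsto_bracketBot w f).const_mul c).congr fun x => (bracket_smul _ c f.2.1 x).symm)

end BracketFunctionals

section BracketSymmetries

theorem bracket_conj (f g : ℝ → ℂ) (x : ℝ) :
    bracket (fun x => conj (f x)) (fun x => conj (g x)) x = conj (bracket f g x) := by
  simp only [bracket, deriv_conj, map_sub, map_mul]

theorem bracket_comp_neg (f g : ℝ → ℂ) (x : ℝ) :
    bracket (fun x => f (-x)) (fun x => g (-x)) x = -bracket f g (-x) := by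
  rw [bracket_eq_wronskian, bracket_eq_wronskian, wronskian_comp_neg fun x => conj (f x)]

theorem bracket_conj_right {w : ℝ → ℂ} (hw : ∀ x, (w x).im = 0) (f : ℝ → ℂ) (x : ℝ) :
    bracket w (fun x => conj (f x)) x = conj (bracket w f x) := by
  rw [← bracket_conj, funext fun x => Complex.conj_eq_iff_im.2 (hw x)]

end BracketSymmetries

section BoundaryFunctional

/-- The functional `s ↦ a s₀ + b s₁ - c s₂ - d s₃` on boundary values. -/
def boundaryFunctional (a b c d : ℂ) : Module.Dual ℂ (Fin 4 → ℂ) :=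
  dotProductEquiv ℂ (Fin 4) ![a, b, -c, -d]

theorem boundaryFunctional_apply (a b c d : ℂ) (s : Fin 4 → ℂ) :
    boundaryFunctional a b c d s = a * s 0 + b * s 1 - (c * s 2 + d * s 3) := by
  change ![a, b, -c, -d] ⬝ᵥ s = _
  simp only [dotProduct, Fin.sum_univ_four, Matrix.cons_val]
  ring

theorem exists_eq_boundaryFunctional (φ : Module.Dual ℂ (Fin 4 → ℂ)) :
    ∃ a b c d, φ = boundaryFunctional a b c d := by
  obtain ⟨v, rfl⟩ := (dotProductEquiv ℂ (Fin 4)).surjective φ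
  refine ⟨v 0, v 1, -v 2, -v 3, congrArg _ (funext fun i => ?_)⟩
  fin_cases i <;> simp

theorem boundaryFunctional_eq_zero_iff {a b c d : ℂ} :
    boundaryFunctional a b c d = 0 ↔ a = 0 ∧ b = 0 ∧ c = 0 ∧ d = 0 := by
  simp [boundaryFunctional]

theorem finrank_ker_of_ne_zero {φ : Module.Dual ℂ (Fin 4 → ℂ)} (h : φ ≠ 0) :
    Module.finrank ℂ φ.ker = 3 := by
  simpa using Module.Dual.finrank_ker_add_one_of_ne_zero h

end BoundaryFunctional

namespace IsBoundaryPair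

variable {q : ℝ → ℝ} {w₁ w₂ : ℝ → ℂ} (hw : IsBoundaryPair q w₁ w₂)

/-- The boundary values `(α₁(f), α₂(f), β₁(f), β₂(f))`. -/
def boundaryMap : maxDomain q →ₗ[ℂ] (Fin 4 → ℂ) :=
  LinearMap.pi ![bracketBotLM ⟨w₁, hw.mem₁⟩, bracketBotLM ⟨w₂, hw.mem₂⟩,
    bracketTopLM ⟨w₁, hw.mem₁⟩, bracketTopLM ⟨w₂, hw.mem₂⟩]

theorem boundaryMap_apply (f : maxDomain q) : hw.boundaryMap f =
    ![bracketBot w₁ f, bracketBot w₂ f, bracketTop w₁ f, bracketTop w₂ f] := by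
  ext i
  fin_cases i <;> rfl

theorem boundaryMap_solutions (s t : ℂ) :
    hw.boundaryMap (s • ⟨w₂, hw.mem₂⟩ - t • ⟨w₁, hw.mem₁⟩) = ![s, t, s, t] := by
  have hpair := hw.isFundamentalPair.wronskian_eq_one
  have h₁₁ : bracket w₁ w₁ = fun _ => 0 := by
    rw [bracket_of_real hw.real₁, funext (wronskian_self w₁)]
  have h₁₂ : bracket w₁ w₂ = fun _ => 1 := by
    rw [bracket_of_real hw.real₁, funext hpair]
  have h₂₁ : bracket w₂ w₁ = fun _ => -1 := by
    rw [bracket_of_real hw.real₂]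
    ext x
    rw [← hpair x, wronskian, wronskian]
    ring
  have h₂₂ : bracket w₂ w₂ = fun _ => 0 := by
    rw [bracket_of_real hw.real₂, funext (wronskian_self w₂)]
  have hlim (F : Filter ℝ) [F.NeBot] (c : ℂ) : limUnder F (fun _ => c) = c :=
    tendsto_const_nhds.limUnder_eq
  rw [map_sub, map_smul, map_smul, boundaryMap_apply, boundaryMap_apply]
  ext i
  fin_cases i <;> simp [bracketTop, bracketBot, h₁₁, h₁₂, h₂₁, h₂₂, hlim]

theorem exists_boundaryMap_eq_top (y : maxDomain q) :
    ∃ z, hw.boundaryMap z = ![0, 0, hw.boundaryMap y 2, hw.boundaryMap y 3] := by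
  obtain ⟨z, hbot, htop⟩ := exists_maxDomain_cutoff y
  have hzero (w : maxDomain q) : bracketBot w z = 0 :=
    (bracketBot_congr w hbot).trans (map_zero (bracketBotLM w))
  refine ⟨z, ?_⟩
  rw [boundaryMap_apply, boundaryMap_apply, bracketTop_congr w₁ htop, bracketTop_congr w₂ htop,
    hzero ⟨w₁, hw.mem₁⟩, hzero ⟨w₂, hw.mem₂⟩]
  rfl

theorem boundaryMap_surjective : Function.Surjective hw.boundaryMap := by
  intro s
  obtain ⟨z, hz⟩ := hw.exists_boundaryMap_eq_top
    ((s 2 - s 0) • ⟨w₂, hw.mem₂⟩ - (s 3 - s 1) • ⟨w₁, hw.mem₁⟩)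
  refine ⟨s 0 • ⟨w₂, hw.mem₂⟩ - s 1 • ⟨w₁, hw.mem₁⟩ + z, ?_⟩
  rw [map_add, hz, boundaryMap_solutions, boundaryMap_solutions]
  ext i
  fin_cases i <;> simp

include hw in
theorem bracket_eq_sub (f g : ℝ → ℂ) (x : ℝ) :
    bracket f g x = conj (bracket w₁ f x) * bracket w₂ g x -
      conj (bracket w₂ f x) * bracket w₁ g x := by
  have h := wronskian_mul_wronskian (fun x => conj (f x)) g w₁ w₂ x
  rwa [hw.isFundamentalPair.wronskian_eq_one, one_mul, ← bracket_eq_wronskian,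
    ← bracket_of_real hw.real₁, ← bracket_of_real hw.real₁, ← bracket_of_real hw.real₂,
    ← bracket_of_real hw.real₂, bracket_conj_right hw.real₁, bracket_conj_right hw.real₂] at h

include hw in
theorem bracketTop_eq_sub (f g : maxDomain q) :
    bracketTop f g = conj (bracketTop w₁ f) * bracketTop w₂ g -
      conj (bracketTop w₂ f) * bracketTop w₁ g := by
  have h₁ := tendsto_bracketTop ⟨w₁, hw.mem₁⟩
  have h₂ := tendsto_bracketTop ⟨w₂, hw.mem₂⟩
  exact tendsto_nhds_unique (tendsto_bracketTop f g) <|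
    (((h₁ f).star.mul (h₂ g)).sub ((h₂ f).star.mul (h₁ g))).congr fun x =>
      (hw.bracket_eq_sub f g x).symm

include hw in
theorem bracketBot_eq_sub (f g : maxDomain q) :
    bracketBot f g = conj (bracketBot w₁ f) * bracketBot w₂ g -
      conj (bracketBot w₂ f) * bracketBot w₁ g := by
  have h₁ := tendsto_bracketBot ⟨w₁, hw.mem₁⟩
  have h₂ := tendsto_bracketBot ⟨w₂, hw.mem₂⟩
  exact tendsto_nhds_unique (tendsto_bracketBot f g) <|
    (((h₁ f).star.mul (h₂ g)).sub ((h₂ f).star.mul (h₁ g))).congr fun x =>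
      (hw.bracket_eq_sub f g x).symm

theorem bracketTop_sub_bracketBot_eq_boundaryFunctional (f g : maxDomain q) :
    bracketTop f g - bracketBot f g =
      boundaryFunctional (conj (hw.boundaryMap f 1)) (-conj (hw.boundaryMap f 0))
        (conj (hw.boundaryMap f 3)) (-conj (hw.boundaryMap f 2)) (hw.boundaryMap g) := by
  rw [hw.bracketTop_eq_sub, hw.bracketBot_eq_sub, boundaryFunctional_apply, boundaryMap_apply,
    boundaryMap_apply]
  simp only [Matrix.cons_val]
  ring

theorem exists_bracketTop_sub_bracketBot_eq (φ : Module.Dual ℂ (Fin 4 → ℂ)) :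
    ∃ z : maxDomain q, ∀ y : maxDomain q,
      bracketTop z y - bracketBot z y = φ (hw.boundaryMap y) := by
  obtain ⟨a, b, c, d, rfl⟩ := exists_eq_boundaryFunctional φ
  obtain ⟨z, hz⟩ := hw.boundaryMap_surjective ![-conj b, conj a, -conj d, conj c]
  refine ⟨z, fun y => ?_⟩
  rw [hw.bracketTop_sub_bracketBot_eq_boundaryFunctional, hz]
  simp only [Matrix.cons_val, map_neg, Complex.conj_conj, neg_neg]

theorem toL2_mem_minOp_domain_iff_boundaryMap (hq : LocallyIntegrable q volume)
    {y : maxDomain q} : toL2 q y ∈ (minOp q).domain ↔ hw.boundaryMap y = 0 := by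
  rw [toL2_mem_minOp_domain_iff hq]
  constructor
  · refine fun h => (Module.forall_dual_apply_eq_zero_iff ℂ _).1 fun φ => ?_
    obtain ⟨z, hz⟩ := hw.exists_bracketTop_sub_bracketBot_eq φ
    rw [← hz, h]
  · intro h z
    rw [hw.bracketTop_sub_bracketBot_eq_boundaryFunctional, h, map_zero]

end IsBoundaryPair

section Representative

variable {q : ℝ → ℝ} {T : L2 →ₗ.[ℂ] L2} (hT : T ≤ maxOp q)

/-- The representative in the maximal domain of an element of the domain of a restriction of
`A_max`; boundary values are defined for functions, not for classes in `L²(ℝ)`. -/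
def representative : T.domain →ₗ[ℂ] maxDomain q :=
  (LinearEquiv.ofInjective (toL2 q) (toL2_injective q)).symm.toLinearMap ∘ₗ
    Submodule.inclusion hT.1

theorem toL2_representative (f : T.domain) : toL2 q (representative hT f) = f :=
  congrArg Subtype.val ((LinearEquiv.ofInjective (toL2 q)
    (toL2_injective q)).apply_symm_apply (Submodule.inclusion hT.1 f))

theorem representative_toL2 (y : maxDomain q) (h : toL2 q y ∈ T.domain) :
    representative hT ⟨toL2 q y, h⟩ = y :=
  toL2_injective q (toL2_representative hT _)

end Representative

namespace IsBoundaryPair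

variable {q : ℝ → ℝ} {w₁ w₂ : ℝ → ℂ} (hw : IsBoundaryPair q w₁ w₂) {T : L2 →ₗ.[ℂ] L2}
  {a b c d : ℂ}

/-- The space of boundary values attained on the domain of a restriction `T` of `A_max`. -/
def boundaryRange (hT : T ≤ maxOp q) : Submodule ℂ (Fin 4 → ℂ) :=
  LinearMap.range (hw.boundaryMap ∘ₗ representative hT)

theorem hasBoundaryCondition_iff :
    HasBoundaryCondition q w₁ w₂ a b c d T ↔ T ≤ maxOp q ∧ ∀ y : maxDomain q,
      toL2 q y ∈ T.domain ↔ boundaryFunctional a b c d (hw.boundaryMap y) = 0 := by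
  have hiff (y : maxDomain q) : boundaryFunctional a b c d (hw.boundaryMap y) = 0 ↔
      a * bracketBot w₁ y + b * bracketBot w₂ y = c * bracketTop w₁ y + d * bracketTop w₂ y := by
    rw [boundaryFunctional_apply, boundaryMap_apply, sub_eq_zero]
    rfl
  simp only [hiff]
  refine and_congr_right fun hT => ⟨fun h y => ?_, fun h f => ⟨fun hf => ?_, ?_⟩⟩
  · rw [h]
    exact ⟨fun ⟨z, hz, hz'⟩ => toL2_injective q hz ▸ hz', fun hy => ⟨y, rfl, hy⟩⟩
  · obtain ⟨y, rfl⟩ := hT.1 hf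
    exact ⟨y, rfl, (h y).1 hf⟩
  · rintro ⟨y, rfl, hy⟩
    exact (h y).2 hy

include hw in
theorem isClosed_of_hasBoundaryCondition (hq : LocallyIntegrable q volume)
    (h : HasBoundaryCondition q w₁ w₂ a b c d T) : T.IsClosed := by
  obtain ⟨hT, hdom⟩ := hw.hasBoundaryCondition_iff.1 h
  obtain ⟨z, hz⟩ := hw.exists_bracketTop_sub_bracketBot_eq (boundaryFunctional a b c d)
  have hgraph : (T.graph : Set (L2 × L2)) = ((maxOp q).graph : Set (L2 × L2)) ∩
      {p | inner ℂ (tauL2 q z) p.1 - inner ℂ (toL2 q z) p.2 = 0} := by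
    ext p
    simp only [SetLike.mem_coe, mem_inter_iff, mem_ofPred_eq, mem_graph_iff_of_le_maxOp hT,
      mem_maxOp_graph, hdom, ← hz, bracketTop_sub_bracketBot]
    constructor
    · rintro ⟨y, hy, rfl⟩
      exact ⟨⟨y, rfl⟩, hy⟩
    · rintro ⟨⟨y, rfl⟩, hy⟩
      exact ⟨y, hy, rfl⟩
  rw [LinearPMap.IsClosed, hgraph]
  exact (isClosed_maxOp hq).inter (isClosed_eq (by fun_prop) continuous_const)

include hw in
theorem minOp_le_of_hasBoundaryCondition (hq : LocallyIntegrable q volume)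
    (h : HasBoundaryCondition q w₁ w₂ a b c d T) : minOp q ≤ T := by
  obtain ⟨hT, hdom⟩ := hw.hasBoundaryCondition_iff.1 h
  refine LinearPMap.le_of_le_graph fun p hp => ?_
  obtain ⟨y, hy, rfl⟩ := (mem_graph_iff_of_le_maxOp (minOp_le_maxOp hq)).1 hp
  rw [← toL2_mem_domain_iff hT, hdom, (hw.toL2_mem_minOp_domain_iff_boundaryMap hq).1 hy, map_zero]

theorem rank_quotient_minOp_domain (hq : LocallyIntegrable q volume) (hT : T ≤ maxOp q) :
    Module.rank ℂ (T.domain ⧸ (minOp q).domain.submoduleOf T.domain) =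
      (Module.finrank ℂ (hw.boundaryRange hT) : Cardinal) := by
  have hker : (minOp q).domain.submoduleOf T.domain =
      LinearMap.ker (hw.boundaryMap ∘ₗ representative hT) := by
    ext f
    rw [Submodule.submoduleOf, Submodule.mem_comap, Submodule.subtype_apply, LinearMap.mem_ker,
      LinearMap.comp_apply, ← hw.toL2_mem_minOp_domain_iff_boundaryMap hq, toL2_representative]
  rw [hker, Module.finrank_eq_rank]
  exact (LinearMap.quotKerEquivRange _).rank_eq

theorem toL2_mem_domain_iff_boundaryMap_mem (hq : LocallyIntegrable q volume) (hT : T ≤ maxOp q)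
    (hA : minOp q ≤ T) (y : maxDomain q) :
    toL2 q y ∈ T.domain ↔ hw.boundaryMap y ∈ hw.boundaryRange hT := by
  constructor
  · exact fun h => ⟨⟨toL2 q y, h⟩, by rw [LinearMap.comp_apply, representative_toL2]⟩
  · rintro ⟨f, hf⟩
    have hdiff : toL2 q (y - representative hT f) ∈ T.domain :=
      hA.1 ((hw.toL2_mem_minOp_domain_iff_boundaryMap hq).2
        (by rw [map_sub, ← hf, LinearMap.comp_apply, sub_self]))
    rw [map_sub, toL2_representative] at hdiff
    exact (T.domain.sub_mem_iff_left f.2).1 hdiff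

theorem exists_hasBoundaryCondition_of_finrank_eq (hq : LocallyIntegrable q volume)
    (hT : T ≤ maxOp q) (hA : minOp q ≤ T) (h : Module.finrank ℂ (hw.boundaryRange hT) = 3) :
    ∃ a b c d : ℂ, ¬(a = 0 ∧ b = 0 ∧ c = 0 ∧ d = 0) ∧
      HasBoundaryCondition q w₁ w₂ a b c d T := by
  have hlt : hw.boundaryRange hT < ⊤ := by
    refine lt_top_iff_ne_top.2 fun htop => ?_
    rw [htop, finrank_top, Module.finrank_fin_fun] at h
    contradiction
  obtain ⟨φ, hφ, hle⟩ := Submodule.exists_le_ker_of_lt_top _ hlt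
  have heq : hw.boundaryRange hT = LinearMap.ker φ :=
    Submodule.eq_of_le_of_finrank_eq hle (h.trans (finrank_ker_of_ne_zero hφ).symm)
  obtain ⟨a, b, c, d, rfl⟩ := exists_eq_boundaryFunctional φ
  refine ⟨a, b, c, d, mt boundaryFunctional_eq_zero_iff.2 hφ,
    hw.hasBoundaryCondition_iff.2 ⟨hT, fun y => ?_⟩⟩
  rw [hw.toL2_mem_domain_iff_boundaryMap_mem hq hT hA, heq, LinearMap.mem_ker]

theorem boundaryRange_of_hasBoundaryCondition (hq : LocallyIntegrable q volume)
    (h : HasBoundaryCondition q w₁ w₂ a b c d T) :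
    hw.boundaryRange h.1 = LinearMap.ker (boundaryFunctional a b c d) := by
  ext s
  obtain ⟨y, rfl⟩ := hw.boundaryMap_surjective s
  rw [← hw.toL2_mem_domain_iff_boundaryMap_mem hq h.1 (hw.minOp_le_of_hasBoundaryCondition hq h),
    (hw.hasBoundaryCondition_iff.1 h).2, LinearMap.mem_ker]

include hw in
theorem isBiExtension_iff (hq : LocallyIntegrable q volume) : IsBiExtension (minOp q) T 3 ↔
    ∃ a b c d : ℂ, ¬(a = 0 ∧ b = 0 ∧ c = 0 ∧ d = 0) ∧
      HasBoundaryCondition q w₁ w₂ a b c d T := by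
  rw [IsBiExtension, adjoint_minOp hq]
  constructor
  · rintro ⟨-, hA, hT, hrank⟩
    rw [hw.rank_quotient_minOp_domain hq hT, Nat.cast_inj] at hrank
    exact hw.exists_hasBoundaryCondition_of_finrank_eq hq hT hA hrank
  · rintro ⟨a, b, c, d, hne, h⟩
    refine ⟨hw.isClosed_of_hasBoundaryCondition hq h, hw.minOp_le_of_hasBoundaryCondition hq h,
      h.1, ?_⟩
    rw [hw.rank_quotient_minOp_domain hq h.1, hw.boundaryRange_of_hasBoundaryCondition hq h,
      finrank_ker_of_ne_zero (mt boundaryFunctional_eq_zero_iff.1 hne)]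

end IsBoundaryPair

section Eigenvalue

variable {q : ℝ → ℝ} {w₁ w₂ : ℝ → ℂ} {T : L2 →ₗ.[ℂ] L2} {a b c d : ℂ}

theorem exists_smul_add_smul_mem_ker {K V : Type*} [Field K] [AddCommGroup V] [Module K V]
    (φ : Module.Dual K V) {u v : V} (huv : LinearIndependent K ![u, v]) :
    ∃ s t : K, s • u + t • v ≠ 0 ∧ s • u + t • v ∈ LinearMap.ker φ := by
  rw [LinearIndependent.pair_iff] at huv
  by_cases hu : φ u = 0
  · refine ⟨1, 0, fun h => one_ne_zero (huv 1 0 h).1, ?_⟩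
    rw [one_smul, zero_smul, add_zero, LinearMap.mem_ker, hu]
  · refine ⟨φ v, -φ u, fun h => hu (neg_eq_zero.1 (huv _ _ h).2), ?_⟩
    rw [LinearMap.mem_ker, map_add, map_smul, map_smul, smul_eq_mul, smul_eq_mul]
    ring

theorem exists_linearIndependent_isSolution (hq : LocallyIntegrable q volume)
    (htop : LimitCircleAtTop q) (hbot : LimitCircleAtBot q) (l : ℂ) :
    ∃ u v : maxDomain q, LinearIndependent ℂ ![u, v] ∧
      IsSolution q l u ∧ IsSolution q l v := by
  obtain ⟨u, hu, hu₀, hu₁⟩ := exists_isSolution hq l 1 0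
  obtain ⟨v, hv, hv₀, hv₁⟩ := exists_isSolution hq l 0 1
  refine ⟨⟨u, hu.mem_maxDomain htop hbot⟩, ⟨v, hv.mem_maxDomain htop hbot⟩,
    LinearIndependent.pair_iff.2 fun s t hst => ?_, hu, hv⟩
  have hfun : s • u + t • v = 0 := congrArg Subtype.val hst
  have hderiv : s • deriv u 0 + t • deriv v 0 = 0 := by
    rw [← deriv_const_smul s (hu.1.differentiable 0), ← deriv_const_smul t (hv.1.differentiable 0),
      ← deriv_add ((hu.1.differentiable 0).const_smul s) ((hv.1.differentiable 0).const_smul t),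
      hfun]
    exact deriv_const 0 0
  constructor
  · simpa [hu₀, hv₀] using congrFun hfun 0
  · simpa [hu₁, hv₁] using hderiv

theorem tauL2_eq_smul {l : ℂ} {y : maxDomain q} (hy : IsSolution q l y) :
    tauL2 q y = l • toL2 q y :=
  (MemLp.toLp_eq_toLp_iff y.2.2.2 (y.2.2.1.const_smul l)).2 hy.2

theorem IsBoundaryPair.isEigenvalue_of_hasBoundaryCondition (hw : IsBoundaryPair q w₁ w₂)
    (hq : LocallyIntegrable q volume) (htop : LimitCircleAtTop q) (hbot : LimitCircleAtBot q)
    (h : HasBoundaryCondition q w₁ w₂ a b c d T) (l : ℂ) : IsEigenvalue T l := by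
  obtain ⟨hT, hdom⟩ := hw.hasBoundaryCondition_iff.1 h
  obtain ⟨u, v, huv, hu, hv⟩ := exists_linearIndependent_isSolution hq htop hbot l
  obtain ⟨s, t, hne, hker⟩ :=
    exists_smul_add_smul_mem_ker (boundaryFunctional a b c d ∘ₗ hw.boundaryMap) huv
  refine ⟨⟨toL2 q _, (hdom _).2 hker⟩, fun hzero => hne ?_, ?_⟩
  · exact toL2_injective q (hzero.trans (map_zero _).symm)
  · rw [apply_toL2_of_le_maxOp hT]
    exact tauL2_eq_smul ((hu.smul s).add (hv.smul t))

theorem resolventSet_eq_empty (h : ∀ l, IsEigenvalue T l) : resolventSet T = ∅ := by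
  refine eq_empty_of_forall_notMem fun l ⟨R, _, hR⟩ => ?_
  obtain ⟨f, hne, hf⟩ := h l
  have hzero := hR f
  rw [hf, sub_self, map_zero] at hzero
  exact hne hzero.symm

end Eigenvalue

section PTSymmetry

variable {q : ℝ → ℝ} {f w w₁ w₂ : ℝ → ℂ}

theorem memLp_conj_comp_neg (hf : MemLp f 2 volume) : MemLp (fun x => conj (f (-x))) 2 volume :=
  (hf.comp_measurePreserving (Measure.measurePreserving_neg (volume : Measure ℝ))).star

theorem parity_timeReversal_toLp (hf : MemLp f 2 volume) :
    parity (timeReversal (hf.toLp f)) = (memLp_conj_comp_neg hf).toLp _ := by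
  refine Lp.ext ?_
  have hneg := Measure.measurePreserving_neg (volume : Measure ℝ)
  filter_upwards [Lp.coeFn_compMeasurePreserving (timeReversal (hf.toLp f)) hneg,
    (memLp_conj_comp_neg hf).coeFn_toLp, ae_comp_neg (Lp.coeFn_star (hf.toLp f)),
    ae_comp_neg hf.coeFn_toLp] with x hparity hPT hstar hx
  rw [hPT]
  refine hparity.trans (hstar.trans ?_)
  rw [Pi.star_apply, hx]
  rfl

theorem tau_conj_comp_neg (heven : ∀ᵐ x : ℝ, q (-x) = q x) (y : ℝ → ℂ) :
    tau q (fun x => conj (y (-x))) =ᵐ[volume] fun x => conj (tau q y (-x)) := by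
  filter_upwards [tau_comp_neg heven y] with x hx
  rw [tau_conj q fun x => y (-x), hx]

section ConjNeg

variable (heven : ∀ᵐ x : ℝ, q (-x) = q x) (y : maxDomain q)

/-- The action of `PT` on functions of the maximal domain of an even potential, where, unlike on
`L²(ℝ)`, it can be compared with the boundary values. -/
def conjNeg : maxDomain q :=
  ⟨fun x => conj ((y : ℝ → ℂ) (-x)), y.2.1.comp_neg.conj, memLp_conj_comp_neg y.2.2.1,
    (memLp_congr_ae (tau_conj_comp_neg heven y)).2 (memLp_conj_comp_neg y.2.2.2)⟩

theorem toL2_conjNeg : toL2 q (conjNeg heven y) = parity (timeReversal (toL2 q y)) :=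
  (parity_timeReversal_toLp y.2.2.1).symm

theorem tauL2_conjNeg : tauL2 q (conjNeg heven y) = parity (timeReversal (tauL2 q y)) :=
  ((MemLp.toLp_eq_toLp_iff (conjNeg heven y).2.2.2 (memLp_conj_comp_neg y.2.2.2)).2
    (tau_conj_comp_neg heven y)).trans (parity_timeReversal_toLp y.2.2.2).symm

end ConjNeg

theorem bracket_const_mul_left (ε : ℝ) (f g : ℝ → ℂ) (x : ℝ) :
    bracket (fun x => ε * f x) g x = ε * bracket f g x := by
  simp only [bracket, deriv_const_mul_field, map_mul, Complex.conj_ofReal]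
  ring

theorem bracket_conj_comp_neg {ε : ℝ} (hreal : ∀ x, (w x).im = 0)
    (hparity : ∀ x, w (-x) = ε * w x) (f : ℝ → ℂ) (x : ℝ) :
    bracket w (fun x => conj (f (-x))) x = -ε * conj (bracket w f (-x)) := by
  have hw : w = fun x => ε * w (-x) := funext fun x => by rw [← hparity, neg_neg]
  rw [bracket_conj_right hreal fun x => f (-x)]
  conv_lhs => rw [hw]
  rw [bracket_const_mul_left, bracket_comp_neg, map_mul, map_neg, Complex.conj_ofReal, neg_mul,
    mul_neg]

theorem bracketBot_conjNeg (heven : ∀ᵐ x : ℝ, q (-x) = q x) (w : maxDomain q) {ε : ℝ}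
    (hreal : ∀ x, ((w : ℝ → ℂ) x).im = 0) (hparity : ∀ x, (w : ℝ → ℂ) (-x) = ε * (w : ℝ → ℂ) x)
    (y : maxDomain q) : bracketBot w (conjNeg heven y) = -ε * conj (bracketTop w y) := by
  refine tendsto_nhds_unique (tendsto_bracketBot w (conjNeg heven y)) ?_
  exact (((tendsto_bracketTop w y).comp tendsto_neg_atBot_atTop).star.const_mul _).congr
    fun x => (bracket_conj_comp_neg hreal hparity y x).symm

theorem bracketTop_conjNeg (heven : ∀ᵐ x : ℝ, q (-x) = q x) (w : maxDomain q) {ε : ℝ}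
    (hreal : ∀ x, ((w : ℝ → ℂ) x).im = 0) (hparity : ∀ x, (w : ℝ → ℂ) (-x) = ε * (w : ℝ → ℂ) x)
    (y : maxDomain q) : bracketTop w (conjNeg heven y) = -ε * conj (bracketBot w y) := by
  refine tendsto_nhds_unique (tendsto_bracketTop w (conjNeg heven y)) ?_
  exact (((tendsto_bracketBot w y).comp tendsto_neg_atTop_atBot).star.const_mul _).congr
    fun x => (bracket_conj_comp_neg hreal hparity y x).symm

namespace IsBoundaryPair

variable (hw : IsBoundaryPair q w₁ w₂)

theorem boundaryMap_conjNeg (heven : ∀ᵐ x : ℝ, q (-x) = q x) (y : maxDomain q) :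
    hw.boundaryMap (conjNeg heven y) =
      ![conj (hw.boundaryMap y 2), -conj (hw.boundaryMap y 3),
        conj (hw.boundaryMap y 0), -conj (hw.boundaryMap y 1)] := by
  have hodd (x : ℝ) : w₁ (-x) = (-1 : ℝ) * w₁ x := by simp [hw.odd₁]
  have heven' (x : ℝ) : w₂ (-x) = (1 : ℝ) * w₂ x := by simp [hw.even₂]
  rw [boundaryMap_apply, boundaryMap_apply,
    bracketBot_conjNeg heven ⟨w₁, hw.mem₁⟩ hw.real₁ hodd,
    bracketBot_conjNeg heven ⟨w₂, hw.mem₂⟩ hw.real₂ heven',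
    bracketTop_conjNeg heven ⟨w₁, hw.mem₁⟩ hw.real₁ hodd,
    bracketTop_conjNeg heven ⟨w₂, hw.mem₂⟩ hw.real₂ heven']
  simp

theorem boundaryFunctional_conjNeg (heven : ∀ᵐ x : ℝ, q (-x) = q x) (a b : ℂ) (y : maxDomain q) :
    boundaryFunctional a b (conj a) (-conj b) (hw.boundaryMap (conjNeg heven y)) =
      -conj (boundaryFunctional a b (conj a) (-conj b) (hw.boundaryMap y)) := by
  rw [boundaryFunctional_apply, boundaryFunctional_apply, boundaryMap_conjNeg]
  simp only [Matrix.cons_val, map_sub, map_add, map_mul, map_neg, Complex.conj_conj]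
  ring

/-- The restriction of `A_max` to `{f : a α₁(f) + b α₂(f) = c β₁(f) + d β₂(f)}`, realising a
prescribed boundary condition. -/
def boundaryOp (a b c d : ℂ) : L2 →ₗ.[ℂ] L2 :=
  (maxOp q).domRestrict
    ((LinearMap.ker (boundaryFunctional a b c d ∘ₗ hw.boundaryMap)).map (toL2 q))

theorem hasBoundaryCondition_boundaryOp (a b c d : ℂ) :
    HasBoundaryCondition q w₁ w₂ a b c d (hw.boundaryOp a b c d) := by
  refine hw.hasBoundaryCondition_iff.2 ⟨LinearPMap.domRestrict_le, fun y => ⟨?_, fun h => ?_⟩⟩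
  · rintro ⟨⟨z, hz, hzy⟩, -⟩
    exact toL2_injective q hzy ▸ hz
  · exact ⟨⟨y, h, rfl⟩, y, rfl⟩

include hw in
theorem isPTSymmetric_of_hasBoundaryCondition (hq : LocallyIntegrable q volume)
    (heven : ∀ᵐ x : ℝ, q (-x) = q x) {a b : ℂ} {T : L2 →ₗ.[ℂ] L2}
    (h : HasBoundaryCondition q w₁ w₂ a b (conj a) (-conj b) T) : IsPTSymmetric T := by
  obtain ⟨hT, hdom⟩ := hw.hasBoundaryCondition_iff.1 h
  refine ⟨hw.isClosed_of_hasBoundaryCondition hq h,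
    (dense_minOp_domain hq).mono (hw.minOp_le_of_hasBoundaryCondition hq h).1, ?_⟩
  rintro ⟨f, hf⟩
  obtain ⟨y, rfl⟩ := hT.1 hf
  have hPT : toL2 q (conjNeg heven y) ∈ T.domain := by
    rw [hdom, boundaryFunctional_conjNeg, (hdom y).1 hf, map_zero, neg_zero]
  refine ⟨toL2_conjNeg heven y ▸ hPT, ?_⟩
  rw [apply_toL2_of_le_maxOp hT, ← tauL2_conjNeg heven, ← apply_toL2_of_le_maxOp hT _ hPT]
  simp only [toL2_conjNeg]

end IsBoundaryPair

end PTSymmetry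

end SturmLiouville

end

theorem mainTheorem1_general (q : ℝ → ℝ) (hq : LocallyIntegrable q volume)
    (heven : ∀ᵐ x : ℝ, q (-x) = q x)
    (htop : SturmLiouville.LimitCircleAtTop q) (hbot : SturmLiouville.LimitCircleAtBot q) :
    (∃ w₁ w₂ : ℝ → ℂ, SturmLiouville.IsBoundaryPair q w₁ w₂) ∧
    (∀ w₁ w₂ : ℝ → ℂ, SturmLiouville.IsBoundaryPair q w₁ w₂ →
      ∀ T : SturmLiouville.L2 →ₗ.[ℂ] SturmLiouville.L2,
        (SturmLiouville.IsBiExtension (SturmLiouville.minOp q) T 3 ↔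
          ∃ a b c d : ℂ, ¬(a = 0 ∧ b = 0 ∧ c = 0 ∧ d = 0) ∧
            SturmLiouville.HasBoundaryCondition q w₁ w₂ a b c d T) ∧
        (SturmLiouville.IsBiExtension (SturmLiouville.minOp q) T 3 →
          (∀ l : ℂ, SturmLiouville.IsEigenvalue T l) ∧
          SturmLiouville.spectrumOf T = Set.univ)) ∧
    (∃ T : SturmLiouville.L2 →ₗ.[ℂ] SturmLiouville.L2,
      SturmLiouville.IsBiExtension (SturmLiouville.minOp q) T 3 ∧
      SturmLiouville.IsPTSymmetric T ∧ SturmLiouville.resolventSet T = ∅) := by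
  have hpair := SturmLiouville.exists_isBoundaryPair hq heven htop hbot
  refine ⟨hpair, fun w₁ w₂ hw T => ⟨hw.isBiExtension_iff hq, fun hT => ?_⟩, ?_⟩
  · obtain ⟨a, b, c, d, -, hbc⟩ := (hw.isBiExtension_iff hq).1 hT
    have heig := hw.isEigenvalue_of_hasBoundaryCondition hq htop hbot hbc
    exact ⟨heig, compl_univ_iff.2 (SturmLiouville.resolventSet_eq_empty heig)⟩
  · obtain ⟨w₁, w₂, hw⟩ := hpair
    have hbc := hw.hasBoundaryCondition_boundaryOp 1 0 (conj 1) (-conj 0)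
    exact ⟨_, (hw.isBiExtension_iff hq).2 ⟨_, _, _, _, fun h => one_ne_zero h.1, hbc⟩,
      hw.isPTSymmetric_of_hasBoundaryCondition hq heven hbc,
      SturmLiouville.resolventSet_eq_empty
        (hw.isEigenvalue_of_hasBoundaryCondition hq htop hbot hbc)⟩

theorem mainTheorem1 (q : ℝ → ℝ) (hq : LocallyIntegrable q volume)
    (heven : ∀ x, q (-x) = q x)
    (htop : SturmLiouville.LimitCircleAtTop q) (hbot : SturmLiouville.LimitCircleAtBot q) :
    (∃ w₁ w₂ : ℝ → ℂ, SturmLiouville.IsBoundaryPair q w₁ w₂) ∧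
    (∀ w₁ w₂ : ℝ → ℂ, SturmLiouville.IsBoundaryPair q w₁ w₂ →
      ∀ T : SturmLiouville.L2 →ₗ.[ℂ] SturmLiouville.L2,
        (SturmLiouville.IsBiExtension (SturmLiouville.minOp q) T 3 ↔
          ∃ a b c d : ℂ, ¬(a = 0 ∧ b = 0 ∧ c = 0 ∧ d = 0) ∧
            SturmLiouville.HasBoundaryCondition q w₁ w₂ a b c d T) ∧
        (SturmLiouville.IsBiExtension (SturmLiouville.minOp q) T 3 →
          (∀ l : ℂ, l.im ≠ 0 → SturmLiouville.IsEigenvalue T l) ∧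
          SturmLiouville.spectrumOf T = Set.univ)) ∧
    (∃ T : SturmLiouville.L2 →ₗ.[ℂ] SturmLiouville.L2,
      SturmLiouville.IsBiExtension (SturmLiouville.minOp q) T 3 ∧
      SturmLiouville.IsPTSymmetric T ∧ SturmLiouville.resolventSet T = ∅) := by
  obtain ⟨hpair, hext, hPT⟩ := mainTheorem1_general q hq (ae_of_all _ heven) htop hbot
  exact ⟨hpair, fun w₁ w₂ hw T => (hext w₁ w₂ hw T).imp_right fun h hT =>
    (h hT).imp_left fun heig l _ => heig l, hPT⟩
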